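/- **Setting.** A pentapod with linear platform consists of five legs; leg $k$ joins the platform anchor point $m_k=(a_k,0,0)$ on a line $p$ of the moving system ($a_k\in\mathbb R$) with the base anchor point $M_k\in\mathbb R^3$ of the fixed system, and has length $R_k$. It is *architecturally singular* if in every pose of the platform the Plücker coordinates of the five carrier lines of the legs are linearly dependent. It is *of Type 5* if it is not architecturally singular, no three platform anchor points coincide, whenever two platform anchor points coincide the remaining three base anchor points are not collinear, no four base anchor points are collinear, $M_1,\dots,M_5$ are not coplanar, and some affine map of $\mathbb R^3$ onto the line $p$ sends $M_k$ to $m_k$ for all $k$. A pair (platform point $(\mu_0:\mu_1)\in P^1(\mathbb C)$, base point $(\nu_0:\nu_1:\nu_2:\nu_3)\in P^3(\mathbb C)$), finite or ideal, is a *possible leg-replacement* if the array $(\mu_r\nu_s)_{r,s}$ lies in the complex span of the five arrays belonging to $(1:a_k)$, $(1:M_k)$; equivalently, for a suitable leg parameter its condition is a linear combination of the five given ones. The pentapod fulfils the *Duporcq condition* if the base points of all possible leg-replacements form an irreducible straight cubic circle, i.e. a real twisted cubic whose points in the ideal plane are one real point $W$ and the two conjugate cyclic points of the planes orthogonal to $W$.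 Poses of the line $p$ over $\mathbb C$ are described by motion parameters $(n_0:x_0:\dots:x_3:y_0:\dots:y_3)$ normalized by $x_0=1$, with $$x_1^2+x_2^2+x_3^2=x_0^2,\quad y_1^2+y_2^2+y_3^2=8x_0n_0,\quad x_1y_1+x_2y_2+x_3y_3=x_0y_0 ;$$ the point $(a,0,0)$ has position $-(ax_1+y_1,\,ax_2+y_2,\,ax_3+y_3)$. It lies on the sphere with centre $(A,B,C)$ and radius $R$ iff $$\Lambda:\ \tfrac12(a^2+A^2+B^2+C^2-R^2)x_0+aAx_1+aBx_2+aCx_3+ay_0+Ay_1+By_2+Cy_3+4n_0=0 .$$ The configuration set for the leg lengths $(R_1,\dots,R_5)$ is the set of poses satisfying the five sphere conditions. A *self-motion over $\mathbb C$* is a nonconstant holomorphic arc in the configuration set. **Theorem.** Let a pentapod of Type 5 fulfil the Duporcq condition. 1. It has a one-parametric set of self-motions over $\mathbb C$: there are real constants $c_1,\dots,c_5$ such that for real leg lengths $R_1,\dots,R_5$ the pentapod has a self-motion over $\mathbb C$ if and only if $R_k^2-R_l^2=c_k-c_l$ for all $k,l$. Moreover, for all (complex) leg lengths the configuration set is at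 most one-dimensional. 2. Choose any two different legs and number them $1$ and $5$. There is a Cartesian frame of the fixed system with origin $M_1$, with the axes of the moving system kept and its origin moved to $m_1$, and there is $a_2\in\mathbb C$ such that, with $a_3=\overline{a_2}$, the ideal base points in directions $(1,-i,0)$, $(1,i,0)$ and $(0,0,1)$ form possible leg-replacements with the platform points $a_2$, $a_3$ and the ideal point of $p$, respectively. For every such coordinatization, let $a_5$ and $(A_5,B_5,C_5)$ be the coordinates of $m_5$ and $M_5$, and let $\Lambda_1,\Lambda_5$ be the sphere conditions of legs $1$ and $5$. Then $a_5\ne0$, and for all complex leg lengths $R_1,\dots,R_5$ there are unique $p_2,p_3,w\in\mathbb C$ (the leg parameters) such that the five sphere conditions are equivalent, as linear conditions on $(n_0,x_0,\dots,y_3)$, to $\Lambda_1$, $\Lambda_5$ and $$p_2x_0+a_2x_1-ia_2x_2+y_1-iy_2=0,\qquad p_3x_0+a_3x_1+ia_3x_2+y_1+iy_2=0,\qquad wx_0+x_3=0 ;$$ the last condition says that the angle between $p$ and the $z$-axis is constant. Conversely, all complex $p_2,p_3,w,R_1,R_5$ arise in this way. If all $R_k^2$ are real, or if $C_5^2\neq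 a_5^2$, then the pentapod has a self-motion over $\mathbb C$ for these leg lengths if and only if $$w=\frac{C_5}{a_5},\qquad p_2=-\frac{(a_3-a_5)(A_5-iB_5)}{a_5},\qquad p_3=-\frac{(a_2-a_5)(A_5+iB_5)}{a_5}$$ and the one remaining relation between $R_1$ and $R_5$ holds: $$(A_5^2+B_5^2+C_5^2)(a_2+a_3-a_5)+(R_1^2-R_5^2-a_2a_5-a_3a_5+a_5^2)\,a_5=0 .$$ -/

import Mathlib

open Complex

/-- The geometry of a pentapod with linear platform: the `i`-th leg joins the platform anchor
point `m i = (a i, 0, 0)` (moving system) with the base anchor point `M i` (fixed system). -/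
structure Pentapod where
  a : Fin 5 → ℝ
  M : Fin 5 → (Fin 3 → ℝ)

/-- Homogeneous coordinates `(1 : a)` of the finite point with abscissa `a` on the platform line;
the ideal point of that line is `(0 : 1)`. -/
def platformPt (a : ℂ) : Fin 2 → ℂ := ![1, a]

/-- Homogeneous coordinates `(1 : A : B : C)` of a finite point of the base space. -/
def basePt (M : Fin 3 → ℂ) : Fin 4 → ℂ := ![1, M 0, M 1, M 2]

/-- Homogeneous coordinates `(0 : A : B : C)` of the ideal point in direction `(A, B, C)`. -/
def idealPt (v : Fin 3 → ℂ) : Fin 4 → ℂ := ![0, v 0, v 1, v 2]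

/-- A real vector, seen in complex space. -/
def toC (v : Fin 3 → ℝ) : Fin 3 → ℂ := fun k => (v k : ℂ)

/-- A straight cubic circle, as the set of all homogeneous coordinate vectors of its complex
points: an irreducible real cubic space curve (the image of `(s³ : s²t : st² : t³)` under a regular
real projectivity), whose points in the ideal plane are one real ideal point `W` and the two cyclic
points `u ± i v` of the planes orthogonal to the direction `W`. -/
def IsStraightCubicCircle (X : Set (Fin 4 → ℂ)) : Prop :=
  (∃ G : Matrix (Fin 4) (Fin 4) ℝ, G.det ≠ 0 ∧
    X = {N | ∃ c s t : ℂ, c ≠ 0 ∧ ¬ (s = 0 ∧ t = 0) ∧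
      N = c • (G.map ((↑) : ℝ → ℂ)).mulVec ![s ^ 3, s ^ 2 * t, s * t ^ 2, t ^ 3]}) ∧
  ∃ W u v : Fin 3 → ℝ, W ≠ 0 ∧ u ≠ 0 ∧ u ⬝ᵥ u = v ⬝ᵥ v ∧ u ⬝ᵥ v = 0 ∧ u ⬝ᵥ W = 0 ∧ v ⬝ᵥ W = 0 ∧
    {N ∈ X | N 0 = 0} = {N | ∃ c : ℂ, c ≠ 0 ∧
      (N = c • idealPt (toC W) ∨ N = c • idealPt (toC u + I • toC v) ∨
        N = c • idealPt (toC u - I • toC v))}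

/-- Homogeneous motion parameters `(n₀, (x₀,x₁,x₂,x₃), (y₀,y₁,y₂,y₃))`. -/
abbrev MotionParam : Type := ℂ × (Fin 4 → ℂ) × (Fin 4 → ℂ)

namespace MotionParam

def n₀ (q : MotionParam) : ℂ := q.1
def x (q : MotionParam) : Fin 4 → ℂ := q.2.1
def y (q : MotionParam) : Fin 4 → ℂ := q.2.2

/-- The points of the image variety of the kinematic mapping with `x₀ ≠ 0`, normalized by `x₀ = 1`.
Such a point is the (complex) pose of the line in which the point with abscissa `a` is at
`(-a x₁ - y₁, -a x₂ - y₂, -a x₃ - y₃)`. -/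
def IsPose (q : MotionParam) : Prop :=
  q.x 0 = 1 ∧
  (q.x 1) ^ 2 + (q.x 2) ^ 2 + (q.x 3) ^ 2 - (q.x 0) ^ 2 = 0 ∧
  (q.y 1) ^ 2 + (q.y 2) ^ 2 + (q.y 3) ^ 2 - 8 * q.x 0 * q.n₀ = 0 ∧
  q.x 1 * q.y 1 + q.x 2 * q.y 2 + q.x 3 * q.y 3 - q.x 0 * q.y 0 = 0

/-- The sphere condition: the platform point with abscissa `a` is on the sphere with centre `M`
and radius `R`. -/
def SphereCond (a : ℂ) (M : Fin 3 → ℂ) (R : ℂ) (q : MotionParam) : Prop :=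
  1 / 2 * (a ^ 2 + M 0 ^ 2 + M 1 ^ 2 + M 2 ^ 2 - R ^ 2) * q.x 0 +
    a * M 0 * q.x 1 + a * M 1 * q.x 2 + a * M 2 * q.x 3 +
    a * q.y 0 + M 0 * q.y 1 + M 1 * q.y 2 + M 2 * q.y 3 + 4 * q.n₀ = 0

/-- The Darboux condition for the platform point with abscissa `a` and the ideal base point in
direction `(1, β, 0)`. -/
def DarbouxCond (p a β : ℂ) (q : MotionParam) : Prop :=
  p * q.x 0 + a * q.x 1 + a * β * q.x 2 + q.y 1 + β * q.y 2 = 0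

/-- The angle condition for the ideal point of the platform line and the ideal base point in
direction `(0, 0, 1)`; `w` is the cosine of the angle. -/
def AngleCond (w : ℂ) (q : MotionParam) : Prop :=
  w * q.x 0 + q.x 3 = 0

end MotionParam

/-- A set of motion parameters contains a self-motion over `ℂ`: a nonconstant holomorphic arc. -/
def HasSelfMotion (S : Set MotionParam) : Prop :=
  ∃ γ : ℂ → MotionParam, AnalyticOnNhd ℂ γ (Metric.ball 0 1) ∧
    (∀ s ∈ Metric.ball (0 : ℂ) 1, γ s ∈ S) ∧ ∃ s ∈ Metric.ball (0 : ℂ) 1, γ s ≠ γ 0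

/-- An (algebraic) set of motion parameters is at most one-dimensional: some linear projection to
`ℂ` has finite fibres on it. -/
def DimLEOne (S : Set MotionParam) : Prop :=
  ∃ l : MotionParam →ₗ[ℂ] ℂ, ∀ c : ℂ, {q ∈ S | l q = c}.Finite

namespace Pentapod

/-- In every pose `m i = t + a i • d` (with unit direction `d`) of the platform, the Plücker
coordinates of the five carrier lines of the legs, i.e. the rows of the Jacobian, are linearly
dependent. -/
def IsArchitecturallySingular (P : Pentapod) : Prop :=
  ∀ d t : Fin 3 → ℝ, d ⬝ᵥ d = 1 →
    ¬ LinearIndependent ℝ (fun i : Fin 5 =>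
      ((t + P.a i • d - P.M i, crossProduct (P.M i) (t + P.a i • d)) :
        (Fin 3 → ℝ) × (Fin 3 → ℝ)))

/-- The class `𝒫`: not architecturally singular; (i) no three platform anchor points coincide;
(ii) if two platform anchor points coincide, the remaining three base anchor points are not
collinear; (iii) no four base anchor points are collinear. -/
def InClassP (P : Pentapod) : Prop :=
  ¬ P.IsArchitecturallySingular ∧
  (∀ i j k : Fin 5, i ≠ j → i ≠ k → j ≠ k → ¬ (P.a i = P.a j ∧ P.a j = P.a k)) ∧
  (∀ i j : Fin 5, i ≠ j → P.a i = P.a j → ¬ Collinear ℝ (P.M '' {k | k ≠ i ∧ k ≠ j})) ∧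
  (∀ i : Fin 5, ¬ Collinear ℝ (P.M '' {k | k ≠ i}))

/-- The affine relation: a (singular) affinity of space onto the platform line maps each base
anchor point to the corresponding platform anchor point. -/
def AffineRelation (P : Pentapod) : Prop :=
  ∃ κ : (Fin 3 → ℝ) →ᵃ[ℝ] ℝ, ∀ i, κ (P.M i) = P.a i

/-- Type 5: non-planar pentapods of `𝒫` which fulfill the affine relation. -/
def IsType5 (P : Pentapod) : Prop :=
  P.InClassP ∧ ¬ Coplanar ℝ (Set.range P.M) ∧ P.AffineRelation

/-- The complex span of the coefficient arrays `(1, A, B, C; a, aA, aB, aC)` of the five legs: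
up to fixed factors these are the coefficients of `n₀, y₁, y₂, y₃; y₀, x₁, x₂, x₃` in the sphere
condition (the coefficient of `x₀` is free, since it contains the leg length). -/
def legSpace (P : Pentapod) : Submodule ℂ (Matrix (Fin 2) (Fin 4) ℂ) :=
  Submodule.span ℂ (Set.range fun i : Fin 5 =>
    Matrix.vecMulVec (platformPt (P.a i)) (basePt (toC (P.M i))))

/-- A (finite or ideal, real or complex) platform point `m` and base point `N`, in homogeneous
coordinates, form a possible (singular-invariant) leg-replacement: the condition imposed by that leg
is, for a suitable leg parameter, a linear combination of the conditions of the five given legs. -/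
def IsLegReplacement (P : Pentapod) (m : Fin 2 → ℂ) (N : Fin 4 → ℂ) : Prop :=
  m ≠ 0 ∧ N ≠ 0 ∧ Matrix.vecMulVec m N ∈ P.legSpace

/-- The locus of the base anchor points of possible leg-replacements. -/
def baseLocus (P : Pentapod) : Set (Fin 4 → ℂ) :=
  {N | ∃ m, P.IsLegReplacement m N}

/-- The Duporcq condition: the base anchor points of the possible leg-replacements (the centres of
the spheres) form an irreducible straight cubic circle. -/
def DuporcqCondition (P : Pentapod) : Prop :=
  IsStraightCubicCircle P.baseLocus

/-- The complex configurations of the pentapod with leg lengths `R`. -/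
def config (P : Pentapod) (R : Fin 5 → ℂ) : Set MotionParam :=
  {q | q.IsPose ∧ ∀ i, q.SphereCond (P.a i) (toC (P.M i)) (R i)}

/-- The pentapod in the frames with origins `m i` and `M i`, where the axes of the moving frame are
kept and the axes of the fixed frame are rotated by `Q`. -/
def inFrame (P : Pentapod) (i : Fin 5) (Q : Matrix (Fin 3) (Fin 3) ℝ) : Pentapod where
  a k := P.a k - P.a i
  M k := Q.mulVec (P.M k - P.M i)

/-- The coordinatization of a pentapod of Type 5 with Duporcq condition: the `i`-th anchor points
are the origins, the ideal base points `(1, -i, 0)` and `(1, i, 0)` correspond to the (complex)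
platform points with abscissae `a₂` and `conj a₂`, and the ideal base point `(0, 0, 1)` corresponds
to the ideal point of the platform line. -/
structure IsAdaptedFrame (P : Pentapod) (i : Fin 5) (Q : Matrix (Fin 3) (Fin 3) ℝ) (a₂ : ℂ) :
    Prop where
  rot : Q ∈ Matrix.specialOrthogonalGroup (Fin 3) ℝ
  pt₂ : (P.inFrame i Q).IsLegReplacement (platformPt a₂) (idealPt ![1, -I, 0])
  pt₃ : (P.inFrame i Q).IsLegReplacement (platformPt (starRingEnd ℂ a₂)) (idealPt ![1, I, 0])
  pt₄ : (P.inFrame i Q).IsLegReplacement ![0, 1] (idealPt ![0, 0, 1])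

/-- With respect to the adapted frame, the five sphere conditions of the pentapod with leg lengths
`R` are equivalent, as linear conditions on the motion parameters, to the two sphere conditions of
the legs `i` and `j`, the two Darboux conditions with parameters `p₂`, `p₃` and the angle condition
with parameter `w`. -/
def HasLegParameters (P : Pentapod) (i j : Fin 5) (Q : Matrix (Fin 3) (Fin 3) ℝ) (a₂ : ℂ)
    (R : Fin 5 → ℂ) (p₂ p₃ w : ℂ) : Prop :=
  ∀ q : MotionParam,
    (∀ k, q.SphereCond ((P.inFrame i Q).a k) (toC ((P.inFrame i Q).M k)) (R k)) ↔
      (q.SphereCond 0 0 (R i) ∧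
        q.DarbouxCond p₂ a₂ (-I) ∧
        q.DarbouxCond p₃ (starRingEnd ℂ a₂) I ∧
        q.AngleCond w ∧
        q.SphereCond ((P.inFrame i Q).a j) (toC ((P.inFrame i Q).M j)) (R j))

end Pentapod

/-! Up to its constant term, the condition of a leg is linear in the array (platform point) ⊗ (base
point). Since the pentapod is not architecturally singular, the five arrays are independent, and a
choice of leg lengths amounts to a linear functional on their span. Any other basis of rank-one
arrays of this span gives an equivalent system of linear conditions. The straight cubic circle
supplies a convenient one: two genuine legs, the two conjugate cyclic points (Darboux conditions)
and the real ideal point `W`, which the affine relation pairs with the ideal point of the platform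
line (angle condition). See `Pentapod.exists_isAdaptedFrame`, `Pentapod.IsAdapted.span_frameArray`
and `Pentapod.IsAdapted.legParams_iff`.

In isotropic coordinates ξ, η of the direction, the adapted system becomes ξη = 1 - w², (p₂ +
a₂ξ)(p₃ + a₃η) + z² = R₁², and one further equation that is linear in ξ, η, z (`frameEqs_iff`). The
first two always cut out a curve. Hence the dimension is at most one, and vanishing of all four
coefficients of the linear equation suffices for a self-motion.

The vanishing is also necessary: with infinitely many solutions, eliminating z gives a polynomial in
one variable with infinitely many roots, and its coefficients force the linear equation to be
trivial (`coefficients_eq_zero`). This uses that a₂ is not real and that A₅ ± iB₅ ≠ 0, both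
consequences of the absence of trisecants of a twisted cubic. If w² = 1 the first equation splits
into two lines and only one of the coefficients of ξ, η is reached; complex conjugation supplies the
other when the squared lengths are real.

The special leg parameters and the relation between R₁ and R₅ determine the functional up to a
common shift of all R_k², whence the one-parametric set (`Pentapod.IsAdapted.legParams_eq_iff`). -/

/-! ### Twisted cubics have no trisecants -/

/-- The moment vector of the twisted cubic. -/
def cubicVec (s t : ℂ) : Fin 4 → ℂ := ![s ^ 3, s ^ 2 * t, s * t ^ 2, t ^ 3]

/-- The three minors v₀v₂ - v₁², v₁v₃ - v₂², v₀v₃ - v₁v₂ vanish on the cubic. On a combination of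
two of its points they equal c₁c₂(s₁t₂ - s₂t₁)² times s₁s₂, t₁t₂ and s₁t₂ + s₂t₁; these three
factors vanish together only if one of the parameter pairs is zero. -/
theorem cubicVec_parallel_of_add {c₁ c₂ c₃ s₁ t₁ s₂ t₂ s₃ t₃ : ℂ} (hc₁ : c₁ ≠ 0) (hc₂ : c₂ ≠ 0)
    (h₁ : ¬ (s₁ = 0 ∧ t₁ = 0)) (h₂ : ¬ (s₂ = 0 ∧ t₂ = 0))
    (h : c₁ • cubicVec s₁ t₁ + c₂ • cubicVec s₂ t₂ = c₃ • cubicVec s₃ t₃) :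
    s₁ * t₂ = s₂ * t₁ := by
  have e0 := congrFun h 0
  have e1 := congrFun h 1
  have e2 := congrFun h 2
  have e3 := congrFun h 3
  simp [cubicVec] at e0 e1 e2 e3
  by_contra hne
  have hd : s₁ * t₂ - s₂ * t₁ ≠ 0 := sub_ne_zero.mpr hne
  have q1 : c₁ * c₂ * (s₁ * t₂ - s₂ * t₁) ^ 2 * (s₁ * s₂) = 0 := by
    have : (c₁ * s₁ ^ 3 + c₂ * s₂ ^ 3) * (c₁ * (s₁ * t₁ ^ 2) + c₂ * (s₂ * t₂ ^ 2)) =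
        (c₁ * (s₁ ^ 2 * t₁) + c₂ * (s₂ ^ 2 * t₂)) ^ 2 := by rw [e0, e1, e2]; ring
    linear_combination this
  have q2 : c₁ * c₂ * (s₁ * t₂ - s₂ * t₁) ^ 2 * (t₁ * t₂) = 0 := by
    have : (c₁ * (s₁ ^ 2 * t₁) + c₂ * (s₂ ^ 2 * t₂)) * (c₁ * t₁ ^ 3 + c₂ * t₂ ^ 3) =
        (c₁ * (s₁ * t₁ ^ 2) + c₂ * (s₂ * t₂ ^ 2)) ^ 2 := by rw [e1, e2, e3]; ring
    linear_combination this
  have q3 : c₁ * c₂ * (s₁ * t₂ - s₂ * t₁) ^ 2 * (s₁ * t₂ + s₂ * t₁) = 0 := by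
    have : (c₁ * s₁ ^ 3 + c₂ * s₂ ^ 3) * (c₁ * t₁ ^ 3 + c₂ * t₂ ^ 3) =
        (c₁ * (s₁ ^ 2 * t₁) + c₂ * (s₂ ^ 2 * t₂)) *
          (c₁ * (s₁ * t₁ ^ 2) + c₂ * (s₂ * t₂ ^ 2)) := by rw [e0, e1, e2, e3]; ring
    linear_combination this
  have hk : c₁ * c₂ * (s₁ * t₂ - s₂ * t₁) ^ 2 ≠ 0 :=
    mul_ne_zero (mul_ne_zero hc₁ hc₂) (pow_ne_zero 2 hd)
  have r1 := (mul_eq_zero.mp q1).resolve_left hk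
  have r2 := (mul_eq_zero.mp q2).resolve_left hk
  have r3 := (mul_eq_zero.mp q3).resolve_left hk
  rcases mul_eq_zero.mp r1 with h | h <;> rcases mul_eq_zero.mp r2 with h' | h' <;>
    simp_all

theorem exists_smul_of_mul_eq {s₁ t₁ s₂ t₂ : ℂ} (h₂ : ¬ (s₂ = 0 ∧ t₂ = 0))
    (h : s₁ * t₂ = s₂ * t₁) : ∃ c : ℂ, s₁ = c * s₂ ∧ t₁ = c * t₂ := by
  by_cases hs : s₂ = 0
  · have ht : t₂ ≠ 0 := fun ht => h₂ ⟨hs, ht⟩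
    refine ⟨t₁ / t₂, ?_, by field_simp⟩
    subst hs
    have : s₁ = 0 := by simpa [ht] using h
    simp [this]
  · refine ⟨s₁ / s₂, by field_simp, ?_⟩
    field_simp
    linear_combination -h

/-- A twisted cubic has no trisecants. -/
theorem IsStraightCubicCircle.parallel_of_add_mem {X : Set (Fin 4 → ℂ)}
    (hX : IsStraightCubicCircle X) {p q : Fin 4 → ℂ} (hp : p ∈ X) (hq : q ∈ X)
    (hpq : p + q ∈ X) : ∃ c : ℂ, p = c • q := by
  obtain ⟨⟨G, hG, rfl⟩, -⟩ := hX
  obtain ⟨c₁, s₁, t₁, hc₁, h₁, rfl⟩ := hp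
  obtain ⟨c₂, s₂, t₂, hc₂, h₂, rfl⟩ := hq
  obtain ⟨c₃, s₃, t₃, hc₃, h₃, h⟩ := hpq
  have hdet : (G.map ((↑) : ℝ → ℂ)).det ≠ 0 := by
    have : (G.map ((↑) : ℝ → ℂ)).det = ((G.det : ℝ) : ℂ) :=
      (RingHom.map_det Complex.ofRealHom G).symm
    rw [this]; exact_mod_cast hG
  have hinj := Matrix.mulVec_injective_of_isUnit
    ((Matrix.isUnit_iff_isUnit_det _).mpr (isUnit_iff_ne_zero.mpr hdet))
  simp only [← Matrix.mulVec_smul, ← Matrix.mulVec_add] at h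
  have h' := hinj h
  obtain ⟨c, rfl, rfl⟩ := exists_smul_of_mul_eq h₂
    (cubicVec_parallel_of_add (s₃ := s₃) (t₃ := t₃) hc₁ hc₂ h₁ h₂ h')
  refine ⟨c₁ * c ^ 3 / c₂, ?_⟩
  rw [smul_smul, div_mul_cancel₀ _ hc₂, ← Matrix.mulVec_smul, ← Matrix.mulVec_smul]
  congr 1
  ext k
  fin_cases k <;> simp <;> ring

/-! ### The span of the coefficient arrays of the legs -/

namespace Pentapod

/-- The coefficient array of the `k`-th leg. -/
def legArray (P : Pentapod) (k : Fin 5) : Matrix (Fin 2) (Fin 4) ℂ :=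
  Matrix.vecMulVec (platformPt (P.a k)) (basePt (toC (P.M k)))

theorem legArray_mem (P : Pentapod) (k : Fin 5) : P.legArray k ∈ P.legSpace :=
  Submodule.subset_span ⟨k, rfl⟩

theorem legSpace_eq (P : Pentapod) : P.legSpace = Submodule.span ℂ (Set.range P.legArray) := rfl

/-- The real part of the coefficient array of the `k`-th leg. -/
def realArray (P : Pentapod) (k : Fin 5) : Matrix (Fin 2) (Fin 4) ℝ :=
  Matrix.vecMulVec ![1, P.a k] ![1, P.M k 0, P.M k 1, P.M k 2]

theorem legArray_apply (P : Pentapod) (k : Fin 5) (r : Fin 2) (s : Fin 4) :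
    P.legArray k r s = (P.realArray k r s : ℂ) := by
  fin_cases r <;> fin_cases s <;>
    simp [legArray, realArray, platformPt, basePt, toC, Matrix.vecMulVec_apply]

/-- In a fixed pose the Plücker coordinates of a leg are linear functions of its coefficient array,
so a dependency of the arrays would persist in every pose. -/
theorem linearIndependent_realArray (P : Pentapod) (h : ¬ P.IsArchitecturallySingular) :
    LinearIndependent ℝ P.realArray := by
  simp only [IsArchitecturallySingular, not_forall, not_not] at h
  obtain ⟨d, t, -, hl⟩ := h
  rw [Fintype.linearIndependent_iff] at hl ⊢
  intro g hg
  apply hl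
  have key : ∀ r s, ∑ k, g k * P.realArray k r s = 0 := by
    intro r s
    simpa [Matrix.sum_apply] using congrFun (congrFun hg r) s
  have k00 := key 0 0
  have k01 := key 0 1
  have k02 := key 0 2
  have k03 := key 0 3
  have k10 := key 1 0
  have k11 := key 1 1
  have k12 := key 1 2
  have k13 := key 1 3
  simp only [realArray, Matrix.vecMulVec_apply, Fin.sum_univ_five] at k00 k01 k02 k03 k10 k11 k12 k13
  simp at k00 k01 k02 k03 k10 k11 k12 k13
  rw [Fin.sum_univ_five]
  refine Prod.ext ?_ ?_
  · ext r
    fin_cases r <;> simp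
    · linear_combination t 0 * k00 + d 0 * k10 - k01
    · linear_combination t 1 * k00 + d 1 * k10 - k02
    · linear_combination t 2 * k00 + d 2 * k10 - k03
  · ext r
    fin_cases r <;> simp [cross_apply]
    · linear_combination t 2 * k02 + d 2 * k12 - t 1 * k03 - d 1 * k13
    · linear_combination t 0 * k03 + d 0 * k13 - t 2 * k01 - d 2 * k11
    · linear_combination t 1 * k01 + d 1 * k11 - t 0 * k02 - d 0 * k12

/-- The arrays are real, so a complex relation splits into its real and imaginary parts. -/
theorem linearIndependent_legArray (P : Pentapod) (h : ¬ P.IsArchitecturallySingular) :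
    LinearIndependent ℂ P.legArray := by
  have hl := P.linearIndependent_realArray h
  rw [Fintype.linearIndependent_iff] at hl ⊢
  intro g hg
  have key : ∀ r s, ∑ k, g k * (P.realArray k r s : ℂ) = 0 := by
    intro r s
    simpa [Matrix.sum_apply, legArray_apply] using congrFun (congrFun hg r) s
  intro k
  refine Complex.ext ?_ ?_
  · refine hl (fun k => (g k).re) ?_ k
    ext r s
    simpa [Matrix.sum_apply] using congrArg Complex.re (key r s)
  · refine hl (fun k => (g k).im) ?_ k
    ext r s
    simpa [Matrix.sum_apply] using congrArg Complex.im (key r s)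

/-- The space of coefficient arrays is invariant under complex conjugation. -/
theorem map_conj_mem_legSpace (P : Pentapod) {T : Matrix (Fin 2) (Fin 4) ℂ} (hT : T ∈ P.legSpace) :
    T.map (starRingEnd ℂ) ∈ P.legSpace := by
  refine Submodule.span_induction (p := fun T _ => T.map (starRingEnd ℂ) ∈ P.legSpace)
    ?_ ?_ ?_ ?_ hT
  · rintro _ ⟨k, rfl⟩
    have : (P.legArray k).map (starRingEnd ℂ) = P.legArray k := by
      ext r s
      simp [legArray_apply]
    exact this ▸ P.legArray_mem k
  · have : (0 : Matrix (Fin 2) (Fin 4) ℂ).map (starRingEnd ℂ) = 0 := by ext; simp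
    rw [this]; exact zero_mem _
  · intro x y _ _ hx hy
    have : (x + y).map (starRingEnd ℂ) = x.map (starRingEnd ℂ) + y.map (starRingEnd ℂ) := by
      ext; simp
    exact this ▸ add_mem hx hy
  · intro c x _ hx
    have : (c • x).map (starRingEnd ℂ) = starRingEnd ℂ c • x.map (starRingEnd ℂ) := by
      ext; simp
    exact this ▸ Submodule.smul_mem _ _ hx

theorem IsLegReplacement.conj {P : Pentapod} {m : Fin 2 → ℂ} {N : Fin 4 → ℂ}
    (h : P.IsLegReplacement m N) :
    P.IsLegReplacement (fun k => starRingEnd ℂ (m k)) (fun k => starRingEnd ℂ (N k)) := by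
  obtain ⟨hm, hN, h⟩ := h
  refine ⟨fun h0 => hm ?_, fun h0 => hN ?_, ?_⟩
  · ext k; simpa using congrFun h0 k
  · ext k; simpa using congrFun h0 k
  · convert P.map_conj_mem_legSpace h using 1
    ext r s
    simp [Matrix.vecMulVec_apply]

theorem IsLegReplacement.smul {P : Pentapod} {m : Fin 2 → ℂ} {N : Fin 4 → ℂ}
    (h : P.IsLegReplacement m N) {c d : ℂ} (hc : c ≠ 0) (hd : d ≠ 0) :
    P.IsLegReplacement (c • m) (d • N) := by
  obtain ⟨hm, hN, h⟩ := h
  refine ⟨smul_ne_zero hc hm, smul_ne_zero hd hN, ?_⟩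
  rw [Matrix.smul_vecMulVec, Matrix.vecMulVec_smul]
  exact Submodule.smul_mem _ _ (Submodule.smul_mem _ _ h)

theorem basePt_ne_zero (v : Fin 3 → ℂ) : basePt v ≠ 0 := fun h => by
  simpa [basePt] using congrFun h 0

theorem platformPt_ne_zero (a : ℂ) : platformPt a ≠ 0 := fun h => by
  simpa [platformPt] using congrFun h 0

theorem isLegReplacement_leg (P : Pentapod) (k : Fin 5) :
    P.IsLegReplacement (platformPt (P.a k)) (basePt (toC (P.M k))) :=
  ⟨platformPt_ne_zero _, basePt_ne_zero _, P.legArray_mem k⟩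

/-- No line contains three base points of possible leg-replacements. -/
def NoTrisecant (P : Pentapod) : Prop :=
  ∀ p q : Fin 4 → ℂ, p ∈ P.baseLocus → q ∈ P.baseLocus → p + q ∈ P.baseLocus → ∃ c : ℂ, p = c • q

theorem DuporcqCondition.noTrisecant {P : Pentapod} (h : P.DuporcqCondition) : P.NoTrisecant :=
  fun _ _ hp hq hpq => IsStraightCubicCircle.parallel_of_add_mem h hp hq hpq

/-- Two base points with the same platform point are proportional. -/
theorem NoTrisecant.parallel {P : Pentapod} (h : P.NoTrisecant) {m : Fin 2 → ℂ} {p q : Fin 4 → ℂ}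
    (hp : P.IsLegReplacement m p) (hq : P.IsLegReplacement m q) : ∃ c : ℂ, p = c • q := by
  by_cases h0 : p + q = 0
  · exact ⟨-1, by rw [neg_one_smul]; exact eq_neg_of_add_eq_zero_left h0⟩
  -- For fixed `m` the admissible base vectors form a linear space, so the sum is a third point on
  -- the line.
  · refine h p q ⟨m, hp⟩ ⟨m, hq⟩ ⟨m, hp.1, h0, ?_⟩
    rw [Matrix.vecMulVec_add]
    exact add_mem hp.2.2 hq.2.2

/-- Class `𝒫` excludes only triple coincidences of platform points. Here equal platform points force
proportional, hence equal, base points, and two legs would have the same array. -/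
theorem NoTrisecant.a_ne {P : Pentapod} (h : P.NoTrisecant) (hli : LinearIndependent ℂ P.legArray)
    {i j : Fin 5} (hij : i ≠ j) : P.a i ≠ P.a j := by
  intro ha
  obtain ⟨c, hc⟩ := h.parallel (P.isLegReplacement_leg i) (ha ▸ P.isLegReplacement_leg j)
  have hc1 : c = 1 := by simpa [basePt] using (congrFun hc 0).symm
  refine hij (hli.injective ?_)
  rw [legArray, legArray, ha, hc, hc1, one_smul]

end Pentapod

/-! ### Changes of coordinates -/

/-- The change of the homogeneous platform coordinate which moves the origin to `α`. -/
def platformShift (α : ℂ) : Matrix (Fin 2) (Fin 2) ℂ := !![1, 0; -α, 1]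

/-- The change of the homogeneous base coordinates `M ↦ Q (M - t)`. -/
def baseMotion (Q : Matrix (Fin 3) (Fin 3) ℝ) (t : Fin 3 → ℝ) : Matrix (Fin 4) (Fin 4) ℂ :=
  !![1, 0, 0, 0;
    -(Q.mulVec t 0 : ℂ), Q 0 0, Q 0 1, Q 0 2;
    -(Q.mulVec t 1 : ℂ), Q 1 0, Q 1 1, Q 1 2;
    -(Q.mulVec t 2 : ℂ), Q 2 0, Q 2 1, Q 2 2]

theorem isUnit_platformShift (α : ℂ) : IsUnit (platformShift α) := by
  rw [Matrix.isUnit_iff_isUnit_det]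
  simp [platformShift]

theorem isUnit_baseMotion {Q : Matrix (Fin 3) (Fin 3) ℝ} (hQ : Q.det = 1) (t : Fin 3 → ℝ) :
    IsUnit (baseMotion Q t) := by
  rw [Matrix.isUnit_iff_isUnit_det]
  have : (baseMotion Q t).det = ((Q.det : ℝ) : ℂ) := by
    rw [Matrix.det_succ_row_zero]
    simp [Fin.sum_univ_four, baseMotion, Matrix.det_fin_three, Fin.succAbove]
  simp [this, hQ]

theorem platformShift_mulVec (α a : ℂ) :
    (platformShift α).mulVec (platformPt a) = platformPt (a - α) := by
  ext k
  fin_cases k <;> simp [platformShift, platformPt, Matrix.mulVec, dotProduct]; ring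

theorem platformShift_mulVec_ideal (α : ℂ) : (platformShift α).mulVec ![0, 1] = ![0, 1] := by
  ext k
  fin_cases k <;> simp [platformShift]

theorem baseMotion_mulVec_basePt (Q : Matrix (Fin 3) (Fin 3) ℝ) (t M : Fin 3 → ℝ) :
    (baseMotion Q t).mulVec (basePt (toC M)) = basePt (toC (Q.mulVec (M - t))) := by
  ext k
  fin_cases k <;>
    simp [baseMotion, basePt, toC, Matrix.mulVec, dotProduct, Fin.sum_univ_succ] <;> ring

theorem baseMotion_mulVec_idealPt (Q : Matrix (Fin 3) (Fin 3) ℝ) (t : Fin 3 → ℝ) (v : Fin 3 → ℂ) :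
    (baseMotion Q t).mulVec (idealPt v) = idealPt ((Q.map ((↑) : ℝ → ℂ)).mulVec v) := by
  ext k
  fin_cases k <;>
    simp [baseMotion, idealPt, Matrix.mulVec, dotProduct, Fin.sum_univ_succ]

/-- The action of a pair of coordinate changes on coefficient arrays. -/
def arrayMap (A : Matrix (Fin 2) (Fin 2) ℂ) (B : Matrix (Fin 4) (Fin 4) ℂ) :
    Matrix (Fin 2) (Fin 4) ℂ →ₗ[ℂ] Matrix (Fin 2) (Fin 4) ℂ where
  toFun T := A * T * B.transpose
  map_add' := by intro S T; rw [Matrix.mul_add, Matrix.add_mul]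
  map_smul' := by intro c T; simp

theorem arrayMap_vecMulVec (A : Matrix (Fin 2) (Fin 2) ℂ) (B : Matrix (Fin 4) (Fin 4) ℂ)
    (m : Fin 2 → ℂ) (N : Fin 4 → ℂ) :
    arrayMap A B (Matrix.vecMulVec m N) = Matrix.vecMulVec (A.mulVec m) (B.mulVec N) := by
  change A * Matrix.vecMulVec m N * B.transpose = _
  rw [Matrix.mul_vecMulVec, Matrix.vecMulVec_mul, Matrix.vecMul_transpose]

theorem arrayMap_injective {A : Matrix (Fin 2) (Fin 2) ℂ} {B : Matrix (Fin 4) (Fin 4) ℂ}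
    (hA : IsUnit A) (hB : IsUnit B) : Function.Injective (arrayMap A B) := by
  obtain ⟨⟨A, A', -, hA'⟩, rfl⟩ := hA
  obtain ⟨⟨B, B', hB', hB''⟩, rfl⟩ := hB
  refine Function.LeftInverse.injective (g := fun T => A' * T * B'.transpose) fun T => ?_
  have h1 : B.transpose * B'.transpose = 1 := by
    rw [← Matrix.transpose_mul, hB'', Matrix.transpose_one]
  change A' * (A * T * B.transpose) * B'.transpose = T
  rw [Matrix.mul_assoc A T, ← Matrix.mul_assoc A' A, hA', Matrix.one_mul, Matrix.mul_assoc, h1,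
    Matrix.mul_one]

namespace Pentapod

theorem inFrame_legArray (P : Pentapod) (i : Fin 5) (Q : Matrix (Fin 3) (Fin 3) ℝ)
    (k : Fin 5) : (P.inFrame i Q).legArray k =
    arrayMap (platformShift (P.a i)) (baseMotion Q (P.M i)) (P.legArray k) := by
  rw [legArray, legArray, arrayMap_vecMulVec, platformShift_mulVec, baseMotion_mulVec_basePt]
  simp [inFrame]

theorem inFrame_legSpace (P : Pentapod) (i : Fin 5) (Q : Matrix (Fin 3) (Fin 3) ℝ) :
    (P.inFrame i Q).legSpace =
    P.legSpace.map (arrayMap (platformShift (P.a i)) (baseMotion Q (P.M i))) := by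
  rw [legSpace_eq, legSpace_eq, Submodule.map_span, ← Set.range_comp]
  congr 2
  funext k
  exact P.inFrame_legArray i Q k

theorem inFrame_linearIndependent (P : Pentapod) (i : Fin 5) {Q : Matrix (Fin 3) (Fin 3) ℝ}
    (hQ : Q.det = 1)
    (h : LinearIndependent ℂ P.legArray) :
    LinearIndependent ℂ (P.inFrame i Q).legArray := by
  have : (P.inFrame i Q).legArray =
      arrayMap (platformShift (P.a i)) (baseMotion Q (P.M i)) ∘ P.legArray :=
    funext (P.inFrame_legArray i Q)
  rw [this]
  exact h.map' _ (LinearMap.ker_eq_bot.mpr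
    (arrayMap_injective (isUnit_platformShift _) (isUnit_baseMotion hQ _)))

theorem inFrame_isLegReplacement_iff (P : Pentapod) (i : Fin 5) {Q : Matrix (Fin 3) (Fin 3) ℝ}
    (hQ : Q.det = 1)
    (m : Fin 2 → ℂ) (N : Fin 4 → ℂ) :
    (P.inFrame i Q).IsLegReplacement ((platformShift (P.a i)).mulVec m)
      ((baseMotion Q (P.M i)).mulVec N) ↔ P.IsLegReplacement m N := by
  have hA := isUnit_platformShift (P.a i)
  have hB := isUnit_baseMotion hQ (P.M i)
  rw [IsLegReplacement, IsLegReplacement, inFrame_legSpace, ← arrayMap_vecMulVec,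
    ← SetLike.mem_coe, Submodule.map_coe, (arrayMap_injective hA hB).mem_set_image,
    SetLike.mem_coe]
  have h1 : (platformShift (P.a i)).mulVec m = 0 ↔ m = 0 :=
    ⟨fun h => Matrix.mulVec_injective_of_isUnit hA (h.trans (Matrix.mulVec_zero _).symm),
      fun h => by rw [h, Matrix.mulVec_zero]⟩
  have h2 : (baseMotion Q (P.M i)).mulVec N = 0 ↔ N = 0 :=
    ⟨fun h => Matrix.mulVec_injective_of_isUnit hB (h.trans (Matrix.mulVec_zero _).symm),
      fun h => by rw [h, Matrix.mulVec_zero]⟩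
  rw [ne_eq, ne_eq, h1, h2]

/-- Collinearity is projectively invariant; this is the only trace of the cubic that has to be
carried into the adapted frame. -/
theorem inFrame_noTrisecant (P : Pentapod) (i : Fin 5) {Q : Matrix (Fin 3) (Fin 3) ℝ}
    (hQ : Q.det = 1)
    (h : P.NoTrisecant) : (P.inFrame i Q).NoTrisecant := by
  have key : ∀ p, (baseMotion Q (P.M i)).mulVec p ∈ (P.inFrame i Q).baseLocus →
      p ∈ P.baseLocus := by
    rintro p ⟨m, hm⟩
    obtain ⟨m, rfl⟩ := Matrix.mulVec_surjective_iff_isUnit.mpr (isUnit_platformShift (P.a i)) m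
    exact ⟨m, (P.inFrame_isLegReplacement_iff i hQ m p).mp hm⟩
  intro p q hp hq hpq
  obtain ⟨p, rfl⟩ := Matrix.mulVec_surjective_iff_isUnit.mpr (isUnit_baseMotion hQ (P.M i)) p
  obtain ⟨q, rfl⟩ := Matrix.mulVec_surjective_iff_isUnit.mpr (isUnit_baseMotion hQ (P.M i)) q
  rw [← Matrix.mulVec_add] at hpq
  obtain ⟨c, rfl⟩ := h p q (key p hp) (key q hq) (key _ hpq)
  exact ⟨c, Matrix.mulVec_smul _ _ _⟩

/-! ### The affine relation and the adapted frame -/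

/-- The array relation which expresses the affine relation between the anchor points. -/
theorem AffineRelation.exists_linear {P : Pentapod} (h : P.AffineRelation) :
    ∃ (κ : Fin 3 → ℝ) (κ₀ : ℝ), (∀ k, P.a k = κ₀ + κ ⬝ᵥ P.M k) ∧
      ∀ T ∈ P.legSpace, T 1 0 = κ₀ * T 0 0 + κ 0 * T 0 1 + κ 1 * T 0 2 + κ 2 * T 0 3 := by
  obtain ⟨f, hf⟩ := h
  have hlin : ∀ v : Fin 3 → ℝ, f v = f 0 + (fun r => f.linear (Pi.single r 1)) ⬝ᵥ v := by
    intro v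
    have h1 : f v = f.linear v + f 0 := by simpa using f.map_vadd 0 v
    have h2 : v = ∑ r, v r • (Pi.single r (1 : ℝ) : Fin 3 → ℝ) := by
      ext s
      simp [Finset.sum_apply, Pi.single_apply]
    rw [h1, add_comm, h2, map_sum]
    simp [dotProduct, Finset.sum_apply, Pi.single_apply, mul_comm]
  refine ⟨fun r => f.linear (Pi.single r 1), f 0, fun k => (hf k).symm.trans (hlin _), ?_⟩
  intro T hT
  refine Submodule.span_induction (p := fun T _ => T 1 0 = (f 0 : ℂ) * T 0 0 +
    (f.linear (Pi.single 0 1) : ℝ) * T 0 1 + (f.linear (Pi.single 1 1) : ℝ) * T 0 2 +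
    (f.linear (Pi.single 2 1) : ℝ) * T 0 3) ?_ ?_ ?_ ?_ hT
  · rintro _ ⟨k, rfl⟩
    have := (hf k).symm.trans (hlin (P.M k))
    simp only [dotProduct, Fin.sum_univ_three] at this
    simp [Matrix.vecMulVec_apply, platformPt, basePt, toC, this]
    ring
  · simp
  · intro x y _ _ hx hy
    simp only [Matrix.add_apply, hx, hy]; ring
  · intro c x _ hx
    simp only [Matrix.smul_apply, smul_eq_mul, hx]; ring

end Pentapod

/-- The rotation whose rows are `U`, `V`, `U × V`. -/
def frameRotation (U V : Fin 3 → ℝ) : Matrix (Fin 3) (Fin 3) ℝ :=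
  Matrix.of ![U, V, crossProduct U V]

theorem frameRotation_mem {U V : Fin 3 → ℝ} (hU : U ⬝ᵥ U = 1) (hV : V ⬝ᵥ V = 1)
    (hUV : U ⬝ᵥ V = 0) : frameRotation U V ∈ Matrix.specialOrthogonalGroup (Fin 3) ℝ := by
  simp only [dotProduct, Fin.sum_univ_three] at hU hV hUV
  -- Lagrange's identity |U × V|² = |U|²|V|² - (U·V)².
  have hL : (U 1 * V 2 - U 2 * V 1) ^ 2 + (U 2 * V 0 - U 0 * V 2) ^ 2 +
      (U 0 * V 1 - U 1 * V 0) ^ 2 = 1 := by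
    linear_combination (V 0 * V 0 + V 1 * V 1 + V 2 * V 2) * hU + hV -
      (U 0 * V 0 + U 1 * V 1 + U 2 * V 2) * hUV
  rw [Matrix.mem_specialOrthogonalGroup_iff, Matrix.mem_orthogonalGroup_iff]
  constructor
  · ext r s
    fin_cases r <;> fin_cases s <;>
      simp [frameRotation, Matrix.mul_apply, Fin.sum_univ_three, cross_apply]
    · linear_combination hU
    · linear_combination hUV
    · ring
    · linear_combination hUV
    · linear_combination hV
    · ring
    · ring
    · ring
    · linear_combination hL
  · rw [Matrix.det_fin_three]
    simp [frameRotation, cross_apply]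
    linear_combination hL

theorem map_ofReal_mulVec_toC (Q : Matrix (Fin 3) (Fin 3) ℝ) (v : Fin 3 → ℝ) :
    (Q.map ((↑) : ℝ → ℂ)).mulVec (toC v) = toC (Q.mulVec v) := by
  ext k
  simp [toC, Matrix.mulVec, dotProduct]

theorem idealPt_smul (c : ℂ) (v : Fin 3 → ℂ) : idealPt (c • v) = c • idealPt v := by
  ext k
  fin_cases k <;> simp [idealPt]

theorem Matrix.mulVec_dotProduct_mulVec_of_orthogonal {n R : Type*} [Fintype n] [DecidableEq n]
    [CommRing R] {Q : Matrix n n R} (hQ : Q.transpose * Q = 1) (v w : n → R) :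
    Q.mulVec v ⬝ᵥ Q.mulVec w = v ⬝ᵥ w := by
  rw [Matrix.dotProduct_mulVec, Matrix.vecMul_mulVec, hQ, Matrix.vecMul_one]

theorem transpose_mul_self_of_mem {Q : Matrix (Fin 3) (Fin 3) ℝ}
    (hQ : Q ∈ Matrix.specialOrthogonalGroup (Fin 3) ℝ) : Q.transpose * Q = 1 :=
  (Matrix.mem_orthogonalGroup_iff' (Fin 3) ℝ).mp (Matrix.mem_specialOrthogonalGroup_iff.mp hQ).1

namespace Pentapod

/-- The axes are u, v (normalized) and u × v, which is parallel to W. The platform point of a cyclic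
point is finite, so the affine relation makes the gradient κ orthogonal to u and v. As κ ≠ 0, it is
not orthogonal to W, which forces the platform point of W to be ideal. -/
theorem exists_isAdaptedFrame {P : Pentapod} (hP : P.IsType5) (hD : P.DuporcqCondition)
    (i : Fin 5) : ∃ (Q : Matrix (Fin 3) (Fin 3) ℝ) (a₂ : ℂ), P.IsAdaptedFrame i Q a₂ := by
  have hT := DuporcqCondition.noTrisecant hD
  have hli := P.linearIndependent_legArray hP.1.1
  obtain ⟨κ, κ₀, hκa, hκ⟩ := hP.2.2.exists_linear
  obtain ⟨-, W, u, v, hW, hu, huv, huv0, huW, hvW, hset⟩ := hD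
  have mem : ∀ N, (N = idealPt (toC W) ∨ N = idealPt (toC u + I • toC v) ∨
      N = idealPt (toC u - I • toC v)) → N ∈ P.baseLocus := by
    intro N hN
    have : N ∈ {N ∈ P.baseLocus | N 0 = 0} := by
      rw [hset]
      exact ⟨1, one_ne_zero, by simpa using hN⟩
    exact this.1
  obtain ⟨n, hn⟩ := mem _ (Or.inl rfl)
  obtain ⟨m, hm⟩ := mem _ (Or.inr (Or.inr rfl))
  -- orthonormal frame
  have huu : 0 < u ⬝ᵥ u := lt_of_le_of_ne (by
    simp only [dotProduct]; exact Finset.sum_nonneg fun k _ => mul_self_nonneg _)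
    (fun h => hu (dotProduct_self_eq_zero.mp h.symm))
  obtain ⟨r, hr, hru⟩ : ∃ r : ℝ, 0 < r ∧ u ⬝ᵥ u = r * r :=
    ⟨√(u ⬝ᵥ u), Real.sqrt_pos.mpr huu, (Real.mul_self_sqrt huu.le).symm⟩
  have hr0 := hr.ne'
  set U := r⁻¹ • u with hU
  set V := r⁻¹ • v with hV
  have hUu : u = r • U := by rw [hU, smul_smul, mul_inv_cancel₀ hr0, one_smul]
  have hVv : v = r • V := by rw [hV, smul_smul, mul_inv_cancel₀ hr0, one_smul]
  have hUU : U ⬝ᵥ U = 1 := by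
    rw [hU, smul_dotProduct, dotProduct_smul, hru, smul_eq_mul, smul_eq_mul]; field_simp
  have hVV : V ⬝ᵥ V = 1 := by
    rw [hV, smul_dotProduct, dotProduct_smul, ← huv, hru, smul_eq_mul, smul_eq_mul]; field_simp
  have hUV : U ⬝ᵥ V = 0 := by
    rw [hU, hV, smul_dotProduct, dotProduct_smul, huv0]; simp
  have hQ := frameRotation_mem hUU hVV hUV
  set Q := frameRotation U V with hQdef
  have hdet : Q.det = 1 := (Matrix.mem_specialOrthogonalGroup_iff.mp hQ).2
  have hQQ := transpose_mul_self_of_mem hQ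
  have hrow : ∀ x : Fin 3 → ℝ, U ⬝ᵥ x = 0 → V ⬝ᵥ x = 0 →
      Q.mulVec x = ![0, 0, Q.mulVec x 2] := by
    intro x h1 h2
    ext k
    fin_cases k
    · exact h1
    · exact h2
    · rfl
  have hQ0 : ∀ x : Fin 3 → ℝ, Q.mulVec x = 0 → x = 0 := by
    intro x hx
    rw [← Matrix.one_mulVec x, ← hQQ, ← Matrix.mulVec_mulVec, hx, Matrix.mulVec_zero]
  have hQu : Q.mulVec u = ![r, 0, 0] := by
    rw [hUu]
    ext k
    fin_cases k
    · change U ⬝ᵥ (r • U) = r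
      rw [dotProduct_smul, hUU, smul_eq_mul, mul_one]
    · change V ⬝ᵥ (r • U) = 0
      rw [dotProduct_smul, dotProduct_comm, hUV, smul_zero]
    · change crossProduct U V ⬝ᵥ (r • U) = 0
      rw [dotProduct_smul, dotProduct_comm, dot_self_cross, smul_zero]
  have hQv : Q.mulVec v = ![0, r, 0] := by
    rw [hVv]
    ext k
    fin_cases k
    · change U ⬝ᵥ (r • V) = 0
      rw [dotProduct_smul, hUV, smul_zero]
    · change V ⬝ᵥ (r • V) = r
      rw [dotProduct_smul, hVV, smul_eq_mul, mul_one]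
    · change crossProduct U V ⬝ᵥ (r • V) = 0
      rw [dotProduct_smul, dotProduct_comm, dot_cross_self, smul_zero]
  have hrowW := hrow W (by rw [hU, smul_dotProduct, huW, smul_zero])
    (by rw [hV, smul_dotProduct, hvW, smul_zero])
  have hW2 : Q.mulVec W 2 ≠ 0 := by
    intro h
    rw [h] at hrowW
    exact hW (hQ0 W (hrowW.trans (by ext k; fin_cases k <;> rfl)))
  -- the platform point of the cyclic point is finite
  have hm0 : m 0 ≠ 0 := by
    intro h0
    -- The ideal platform point is real up to a factor, so both conjugate cyclic points would belong
    -- to it.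
    have hm1 := hm.conj
    have hstar : (fun k => starRingEnd ℂ (m k)) =
        (starRingEnd ℂ (m 1) / m 1) • m := by
      have : m 1 ≠ 0 := fun h1 => hm.1 (by ext k; fin_cases k <;> assumption)
      ext k
      fin_cases k
      · simp [h0]
      · simp [this]
    have hm10 : m 1 ≠ 0 := fun h1 => hm.1 (by ext k; fin_cases k <;> assumption)
    have hc : starRingEnd ℂ (m 1) / m 1 ≠ 0 :=
      div_ne_zero (by simpa using hm10) hm10
    rw [hstar] at hm1
    have hm2 := hm1.smul (inv_ne_zero hc) one_ne_zero
    rw [smul_smul, inv_mul_cancel₀ hc, one_smul, one_smul] at hm2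
    obtain ⟨c, hc⟩ := hT.parallel hm hm2
    have hre : ∀ k, (u k : ℂ) - I * v k = c * (u k + I * v k) := by
      intro k
      have := congrFun hc k.succ
      fin_cases k <;> simpa [idealPt, toC] using this
    -- Pairing u - iv = c(u + iv) with u and with v gives 1 - c = 0 and 1 + c = 0.
    have e1 : (1 - c) * ((u ⬝ᵥ u : ℝ) : ℂ) = I * (1 + c) * ((u ⬝ᵥ v : ℝ) : ℂ) := by
      simp only [dotProduct, Fin.sum_univ_three]
      push_cast
      linear_combination u 0 * hre 0 + u 1 * hre 1 + u 2 * hre 2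
    have e2 : (1 - c) * ((u ⬝ᵥ v : ℝ) : ℂ) = I * (1 + c) * ((v ⬝ᵥ v : ℝ) : ℂ) := by
      simp only [dotProduct, Fin.sum_univ_three]
      push_cast
      linear_combination v 0 * hre 0 + v 1 * hre 1 + v 2 * hre 2
    rw [← huv, huv0] at e2
    rw [huv0] at e1
    have huuC : ((u ⬝ᵥ u : ℝ) : ℂ) ≠ 0 := by exact_mod_cast huu.ne'
    have c1 : 1 - c = 0 := by simpa [huuC] using e1
    have c2 : 1 + c = 0 := by simpa [huuC] using e2.symm
    have : (2 : ℂ) = 0 := by linear_combination c1 + c2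
    norm_num at this
  -- For an ideal base point the first column of the array vanishes, and the affine relation reduces
  -- to m₀ κ·(u - iv) = 0.
  have hκm := hκ _ hm.2.2
  simp [Matrix.vecMulVec_apply, idealPt, toC] at hκm
  have hκm' : ((κ ⬝ᵥ u : ℝ) : ℂ) - I * ((κ ⬝ᵥ v : ℝ) : ℂ) = 0 := by
    have : m 0 * (((κ ⬝ᵥ u : ℝ) : ℂ) - I * ((κ ⬝ᵥ v : ℝ) : ℂ)) = 0 := by
      simp only [dotProduct, Fin.sum_univ_three]
      push_cast
      linear_combination -hκm
    exact (mul_eq_zero.mp this).resolve_left hm0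
  have hκu : κ ⬝ᵥ u = 0 := by simpa using congrArg Complex.re hκm'
  have hκv : κ ⬝ᵥ v = 0 := by simpa using congrArg Complex.im hκm'
  have hrowκ := hrow κ (by rw [hU, smul_dotProduct, dotProduct_comm, hκu, smul_zero])
    (by rw [hV, smul_dotProduct, dotProduct_comm, hκv, smul_zero])
  have hn0 : n 0 = 0 := by
    by_contra hn0
    have hκn := hκ _ hn.2.2
    simp [Matrix.vecMulVec_apply, idealPt, toC] at hκn
    have hκW' : n 0 * ((κ ⬝ᵥ W : ℝ) : ℂ) = 0 := by
      simp only [dotProduct, Fin.sum_univ_three]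
      push_cast
      linear_combination -hκn
    have hκW : κ ⬝ᵥ W = 0 := by simpa [hn0] using hκW'
    rw [← Matrix.mulVec_dotProduct_mulVec_of_orthogonal hQQ, hrowκ, hrowW] at hκW
    simp [dotProduct, Fin.sum_univ_three] at hκW
    rw [hκW.resolve_right hW2] at hrowκ
    -- With κ = 0 all platform anchor points would coincide.
    have hκ0 : κ = 0 := hQ0 κ (hrowκ.trans (by ext k; fin_cases k <;> rfl))
    refine hT.a_ne hli (show (0 : Fin 5) ≠ 1 by decide) ?_
    rw [hκa, hκa, hκ0, zero_dotProduct, zero_dotProduct]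
  have hn1 : n 1 ≠ 0 := fun h1 => hn.1 (by ext k; fin_cases k <;> assumption)
  have hpt₂ : (P.inFrame i Q).IsLegReplacement (platformPt (m 1 / m 0 - P.a i))
      (idealPt ![1, -I, 0]) := by
    have h := (P.inFrame_isLegReplacement_iff i hdet _ _).mpr
      (hm.smul (inv_ne_zero hm0) (inv_ne_zero (ofReal_ne_zero.mpr hr0)))
    have e1 : (m 0)⁻¹ • m = platformPt (m 1 / m 0) := by
      ext k
      fin_cases k
      · simp [platformPt, hm0]
      · simp [platformPt]; field_simp
    rw [e1, platformShift_mulVec, ← idealPt_smul, baseMotion_mulVec_idealPt, Matrix.mulVec_smul,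
      Matrix.mulVec_sub, Matrix.mulVec_smul, map_ofReal_mulVec_toC, map_ofReal_mulVec_toC,
      hQu, hQv] at h
    convert h using 2
    have hrC : (r : ℂ) ≠ 0 := ofReal_ne_zero.mpr hr0
    ext k
    fin_cases k
    · simp [toC, hrC]
    · simp [toC]; field_simp
    · simp [toC]
  refine ⟨Q, m 1 / m 0 - P.a i, hQ, hpt₂, ?_, ?_⟩
  · convert hpt₂.conj using 1
    · ext k; fin_cases k <;> simp [platformPt]
    · ext k; fin_cases k <;> simp [idealPt]
  · have hμ : ((Q.mulVec W 2 : ℝ) : ℂ) ≠ 0 := ofReal_ne_zero.mpr hW2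
    have h := (P.inFrame_isLegReplacement_iff i hdet _ _).mpr
      (hn.smul (inv_ne_zero hn1) (inv_ne_zero hμ))
    have e1 : (n 1)⁻¹ • n = ![0, 1] := by
      ext k
      fin_cases k
      · simp [hn0]
      · simp [hn1]
    rw [e1, platformShift_mulVec_ideal, ← idealPt_smul, baseMotion_mulVec_idealPt,
      Matrix.mulVec_smul, map_ofReal_mulVec_toC] at h
    convert h using 2
    ext k
    rw [Pi.smul_apply, toC, hrowW]
    fin_cases k
    · simp
    · simp
    · simp [hμ]

end Pentapod

/-! ### Leg parameters as values of a linear functional -/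

/-- The linear form on motion parameters with a given coefficient array, without its `x₀` term. -/
noncomputable def legForm (q : MotionParam) : Matrix (Fin 2) (Fin 4) ℂ →ₗ[ℂ] ℂ where
  toFun T := 4 * q.n₀ * T 0 0 + q.y 1 * T 0 1 + q.y 2 * T 0 2 + q.y 3 * T 0 3 +
    q.y 0 * T 1 0 + q.x 1 * T 1 1 + q.x 2 * T 1 2 + q.x 3 * T 1 3
  map_add' S T := by simp only [Matrix.add_apply]; ring
  map_smul' c T := by simp only [Matrix.smul_apply, smul_eq_mul, RingHom.id_apply]; ring

/-- The coefficient of `x₀` in the sphere condition. -/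
noncomputable def sphereConst (a : ℂ) (M : Fin 3 → ℂ) (R : ℂ) : ℂ :=
  1 / 2 * (a ^ 2 + M 0 ^ 2 + M 1 ^ 2 + M 2 ^ 2 - R ^ 2)

namespace MotionParam

theorem sphereCond_iff (a : ℂ) (M : Fin 3 → ℂ) (R : ℂ) (q : MotionParam) :
    q.SphereCond a M R ↔ sphereConst a M R * q.x 0 +
      legForm q (Matrix.vecMulVec (platformPt a) (basePt M)) = 0 := by
  rw [SphereCond, sphereConst]
  refine Eq.congr_left ?_
  simp [legForm, platformPt, basePt]
  ring

theorem darbouxCond_iff (p a β : ℂ) (q : MotionParam) :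
    q.DarbouxCond p a β ↔ p * q.x 0 +
      legForm q (Matrix.vecMulVec (platformPt a) (idealPt ![1, β, 0])) = 0 := by
  rw [DarbouxCond]
  refine Eq.congr_left ?_
  simp [legForm, platformPt, idealPt]
  ring

theorem angleCond_iff (w : ℂ) (q : MotionParam) :
    q.AngleCond w ↔ w * q.x 0 +
      legForm q (Matrix.vecMulVec ![0, 1] (idealPt ![0, 0, 1])) = 0 := by
  rw [AngleCond]
  refine Eq.congr_left ?_
  simp [legForm, idealPt]

/-- The parameters `q` need not be a pose, so `legForm q` represents every functional. The linear
system of the legs is therefore solvable with x₀ = 1, which is what makes the leg parameters unique.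
-/
theorem exists_legForm_eq (ρ : Matrix (Fin 2) (Fin 4) ℂ →ₗ[ℂ] ℂ) :
    ∃ q : MotionParam, q.x 0 = 1 ∧ ∀ T, ρ T + legForm q T = 0 := by
  let e : Fin 2 → Fin 4 → ℂ := fun r s => ρ (Matrix.single r s 1)
  refine ⟨(-e 0 0 / 4, ![1, -e 1 1, -e 1 2, -e 1 3], ![-e 1 0, -e 0 1, -e 0 2, -e 0 3]), rfl, ?_⟩
  intro T
  have h : ρ T = ∑ r, ∑ s, T r s * e r s := by
    conv_lhs => rw [Matrix.matrix_eq_sum_single T]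
    simp only [map_sum]
    refine Finset.sum_congr rfl fun r _ => Finset.sum_congr rfl fun s _ => ?_
    rw [← smul_eq_mul, ← map_smul, Matrix.smul_single, smul_eq_mul, mul_one]
  rw [h]
  simp [legForm, Fin.sum_univ_four, n₀, x, y]
  ring

end MotionParam

theorem toC_zero : toC 0 = 0 := by
  ext k
  simp [toC]

theorem exists_functional {T : Fin 5 → Matrix (Fin 2) (Fin 4) ℂ} (h : LinearIndependent ℂ T)
    (r : Fin 5 → ℂ) : ∃ ρ : Matrix (Fin 2) (Fin 4) ℂ →ₗ[ℂ] ℂ, ∀ k, ρ (T k) = r k := by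
  obtain ⟨ρ, hρ⟩ := LinearMap.exists_extend ((Module.Basis.span h).constr ℂ r)
  refine ⟨ρ, fun k => ?_⟩
  have h1 := (Module.Basis.span h).constr_basis ℂ r k
  rw [← hρ] at h1
  simpa [Module.Basis.span_apply] using h1

namespace Pentapod

/-- The coefficient arrays of the conditions of the adapted frame. -/
def frameArray (P : Pentapod) (j : Fin 5) (a₂ : ℂ) : Fin 5 → Matrix (Fin 2) (Fin 4) ℂ :=
  ![Matrix.vecMulVec (platformPt 0) (basePt 0),
    Matrix.vecMulVec (platformPt a₂) (idealPt ![1, -I, 0]),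
    Matrix.vecMulVec (platformPt (starRingEnd ℂ a₂)) (idealPt ![1, I, 0]),
    Matrix.vecMulVec ![0, 1] (idealPt ![0, 0, 1]),
    P.legArray j]

theorem linearIndependent_frameArray (P : Pentapod) (j : Fin 5) (a₂ : ℂ) (ha : P.a j ≠ 0) :
    LinearIndependent ℂ (P.frameArray j a₂) := by
  rw [Fintype.linearIndependent_iff]
  intro g hg
  have key : ∀ r s, ∑ k, g k * P.frameArray j a₂ k r s = 0 := by
    intro r s
    simpa [Matrix.sum_apply] using congrFun (congrFun hg r) s
  have k00 := key 0 0
  have k01 := key 0 1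
  have k02 := key 0 2
  have k10 := key 1 0
  have k13 := key 1 3
  simp [frameArray, legArray, platformPt, basePt, idealPt, toC,
    Fin.sum_univ_five, ha] at k00 k01 k02 k10 k13
  -- Only the array of leg `j` has a nonzero entry at (1, 0), namely its platform coordinate.
  have g4 : g 4 = 0 := k10
  simp only [g4, zero_mul, add_zero] at k00 k01 k02 k13
  have g1 : g 1 = 0 := by linear_combination 1 / 2 * k01 + I / 2 * k02 + (g 1 - g 2) / 2 * I_mul_I
  have g2 : g 2 = 0 := by linear_combination k01 - g1
  intro k
  fin_cases k
  · exact k00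
  · exact g1
  · exact g2
  · exact k13
  · exact g4

/-- The properties of the pentapod in its adapted frame which determine its leg parameters. -/
structure IsAdapted (P : Pentapod) (i j : Fin 5) (a₂ : ℂ) : Prop where
  li : LinearIndependent ℂ P.legArray
  noTri : P.NoTrisecant
  ne : i ≠ j
  a_zero : P.a i = 0
  M_zero : P.M i = 0
  pt₂ : P.IsLegReplacement (platformPt a₂) (idealPt ![1, -I, 0])
  pt₃ : P.IsLegReplacement (platformPt (starRingEnd ℂ a₂)) (idealPt ![1, I, 0])
  pt₄ : P.IsLegReplacement ![0, 1] (idealPt ![0, 0, 1])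

theorem IsAdaptedFrame.isAdapted {P : Pentapod} (hP : ¬ P.IsArchitecturallySingular)
    (hD : P.DuporcqCondition) {i j : Fin 5} (hij : i ≠ j) {Q : Matrix (Fin 3) (Fin 3) ℝ} {a₂ : ℂ}
    (h : P.IsAdaptedFrame i Q a₂) : (P.inFrame i Q).IsAdapted i j a₂ := by
  have hdet : Q.det = 1 := (Matrix.mem_specialOrthogonalGroup_iff.mp h.rot).2
  exact
  { li := P.inFrame_linearIndependent i hdet (P.linearIndependent_legArray hP)
    noTri := P.inFrame_noTrisecant i hdet hD.noTrisecant
    ne := hij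
    a_zero := sub_self _
    M_zero := by simp [inFrame]
    pt₂ := h.pt₂
    pt₃ := h.pt₃
    pt₄ := h.pt₄ }

namespace IsAdapted

variable {P : Pentapod} {i j : Fin 5} {a₂ : ℂ}

theorem a_ne_zero (h : P.IsAdapted i j a₂) : P.a j ≠ 0 := fun ha =>
  h.noTri.a_ne h.li h.ne (h.a_zero.trans ha.symm)

theorem legArray_zero (h : P.IsAdapted i j a₂) :
    P.legArray i = Matrix.vecMulVec (platformPt 0) (basePt 0) := by
  rw [legArray, h.a_zero, h.M_zero]
  congr

/-- A real `a₂` would be paired with both cyclic points, which are not proportional. -/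
theorem conj_ne (h : P.IsAdapted i j a₂) : starRingEnd ℂ a₂ ≠ a₂ := by
  intro he
  obtain ⟨c, hc⟩ := h.noTri.parallel h.pt₂ (he ▸ h.pt₃)
  have h1 := congrFun hc 1
  have h2 := congrFun hc 2
  simp [idealPt] at h1 h2
  rw [← h1, one_mul] at h2
  have := congrArg Complex.im h2
  norm_num at this

/-- The base anchor point of the leg `j` is not on the `z`-axis. -/
theorem not_axis (h : P.IsAdapted i j a₂) : ¬ (P.M j 0 = 0 ∧ P.M j 1 = 0) := by
  rintro ⟨hA, hB⟩
  have hM : basePt (toC (P.M j)) = basePt 0 + (P.M j 2 : ℂ) • idealPt ![0, 0, 1] := by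
    ext k
    fin_cases k <;> simp [basePt, idealPt, toC, hA, hB]
  have hi : basePt 0 ∈ P.baseLocus := ⟨_, platformPt_ne_zero 0, basePt_ne_zero 0,
    h.legArray_zero ▸ P.legArray_mem i⟩
  have hj : basePt (toC (P.M j)) ∈ P.baseLocus := ⟨_, P.isLegReplacement_leg j⟩
  by_cases hC : P.M j 2 = 0
  · -- both legs have the base point `0`, hence every platform point belongs to it
    have hj' := P.legArray_mem j
    have hi' := P.legArray_mem i
    rw [h.legArray_zero] at hi'
    rw [legArray, hM, hC] at hj'
    have hd := sub_mem hj' hi'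
    have e : Matrix.vecMulVec (platformPt (P.a j)) (basePt 0 + ((0 : ℝ) : ℂ) • idealPt ![0, 0, 1]) -
        Matrix.vecMulVec (platformPt 0) (basePt 0) =
        (P.a j : ℂ) • Matrix.vecMulVec ![0, 1] (basePt 0) := by
      ext r s
      rw [Matrix.sub_apply, Matrix.smul_apply, Matrix.vecMulVec_apply, Matrix.vecMulVec_apply,
        Matrix.vecMulVec_apply, ofReal_zero, zero_smul, add_zero]
      fin_cases r <;> simp [platformPt]
    rw [e] at hd
    have hd' := (Submodule.smul_mem_iff _ (ofReal_ne_zero.mpr h.a_ne_zero)).mp hd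
    obtain ⟨c, hc⟩ := h.noTri.parallel ⟨h.pt₄.1, basePt_ne_zero 0, hd'⟩ h.pt₄
    simpa [basePt, idealPt] using congrFun hc 0
  -- The origin, the anchor point of leg `j` and the ideal point of the z-axis would be three base
  -- points on a line.
  · have h4 := h.pt₄.smul one_ne_zero (ofReal_ne_zero.mpr hC)
    obtain ⟨c, hc⟩ := h.noTri _ _ hi ⟨_, h4⟩ (hM ▸ hj)
    simpa [basePt, idealPt] using congrFun hc 0

theorem frameArray_mem (h : P.IsAdapted i j a₂) (k : Fin 5) : P.frameArray j a₂ k ∈ P.legSpace := by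
  have h0 := P.legArray_mem i
  rw [h.legArray_zero] at h0
  fin_cases k
  · exact h0
  · exact h.pt₂.2.2
  · exact h.pt₃.2.2
  · exact h.pt₄.2.2
  · exact P.legArray_mem j

/-- Five independent arrays inside a space of dimension five. -/
theorem span_frameArray (h : P.IsAdapted i j a₂) :
    Submodule.span ℂ (Set.range (P.frameArray j a₂)) = P.legSpace := by
  refine Submodule.eq_of_le_of_finrank_eq ?_ ?_
  · rw [Submodule.span_le]
    rintro _ ⟨k, rfl⟩
    exact h.frameArray_mem k
  · rw [finrank_span_eq_card (P.linearIndependent_frameArray j a₂ h.a_ne_zero), legSpace_eq,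
      finrank_span_eq_card h.li]

/-- Linear forms which agree on the arrays of the adapted frame agree on the arrays of the legs. -/
theorem eq_on_legSpace (h : P.IsAdapted i j a₂) {f g : Matrix (Fin 2) (Fin 4) ℂ →ₗ[ℂ] ℂ}
    (hfg : ∀ k, f (P.frameArray j a₂ k) = g (P.frameArray j a₂ k)) :
    ∀ T ∈ P.legSpace, f T = g T := by
  intro T hT
  rw [← h.span_frameArray] at hT
  exact LinearMap.eqOn_span (by rintro _ ⟨k, rfl⟩; exact hfg k) hT

end IsAdapted

theorem eq_on_legSpace_of_legs (P : Pentapod) {f g : Matrix (Fin 2) (Fin 4) ℂ →ₗ[ℂ] ℂ}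
    (hfg : ∀ k, f (P.legArray k) = g (P.legArray k)) : ∀ T ∈ P.legSpace, f T = g T := by
  intro T hT
  exact LinearMap.eqOn_span (by rintro _ ⟨k, rfl⟩; exact hfg k) hT

/-- The linear form `ρ` yields the `x₀`-coefficients of the legs with lengths `R`. -/
def IsLegFunctional (P : Pentapod) (R : Fin 5 → ℂ)
    (ρ : Matrix (Fin 2) (Fin 4) ℂ →ₗ[ℂ] ℂ) : Prop :=
  ∀ k, ρ (P.legArray k) = sphereConst (P.a k) (toC (P.M k)) (R k)

theorem IsAdapted.exists_isLegFunctional {P : Pentapod} {i j : Fin 5} {a₂ : ℂ}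
    (h : P.IsAdapted i j a₂) (R : Fin 5 → ℂ) : ∃ ρ, P.IsLegFunctional R ρ :=
  exists_functional h.li _

/-- The equivalence of two systems of linear conditions in the adapted frame. -/
def LegParams (P : Pentapod) (i j : Fin 5) (a₂ : ℂ) (R : Fin 5 → ℂ) (p₂ p₃ w : ℂ) : Prop :=
  ∀ q : MotionParam, (∀ k, q.SphereCond (P.a k) (toC (P.M k)) (R k)) ↔
      (q.SphereCond 0 0 (R i) ∧
        q.DarbouxCond p₂ a₂ (-I) ∧
        q.DarbouxCond p₃ (starRingEnd ℂ a₂) I ∧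
        q.AngleCond w ∧
        q.SphereCond (P.a j) (toC (P.M j)) (R j))

/-- The form x₀ρ + `legForm q` vanishes on the legs iff it vanishes on the frame arrays, as both
families span the same space. So the parameters given by ρ work; evaluation at a solution with x₀ =
1 shows that no others do. -/
theorem IsAdapted.legParams_iff {P : Pentapod} {i j : Fin 5} {a₂ : ℂ}
    (h : P.IsAdapted i j a₂) {R : Fin 5 → ℂ} {ρ : Matrix (Fin 2) (Fin 4) ℂ →ₗ[ℂ] ℂ}
    (hρ : P.IsLegFunctional R ρ) (p₂ p₃ w : ℂ) : P.LegParams i j a₂ R p₂ p₃ w ↔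
      p₂ = ρ (P.frameArray j a₂ 1) ∧ p₃ = ρ (P.frameArray j a₂ 2) ∧
        w = ρ (P.frameArray j a₂ 3) := by
  have hi : ρ (P.frameArray j a₂ 0) = sphereConst 0 0 (R i) := by
    have := hρ i
    rw [h.legArray_zero, h.a_zero, h.M_zero] at this
    refine this.trans ?_
    simp [sphereConst, toC]
  have h5 : ∀ k, ρ (P.legArray k) = sphereConst (P.a k) (toC (P.M k)) (R k) := hρ
  have hL : ∀ q : MotionParam, (∀ k, q.SphereCond (P.a k) (toC (P.M k)) (R k)) ↔
      ∀ k, ρ (P.legArray k) * q.x 0 + legForm q (P.legArray k) = 0 := by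
    intro q
    refine forall_congr' fun k => ?_
    rw [MotionParam.sphereCond_iff, hρ k]
    rfl
  have hF : ∀ (q : MotionParam), (∀ k, ρ (P.legArray k) * q.x 0 + legForm q (P.legArray k) = 0) ↔
      ∀ k, ρ (P.frameArray j a₂ k) * q.x 0 + legForm q (P.frameArray j a₂ k) = 0 := by
    intro q
    let F : Matrix (Fin 2) (Fin 4) ℂ →ₗ[ℂ] ℂ := q.x 0 • ρ + legForm q
    have hFa : ∀ T, ρ T * q.x 0 + legForm q T = F T := fun T => by
      simp [F, mul_comm]
    simp only [hFa]
    constructor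
    · intro hz k
      exact P.eq_on_legSpace_of_legs (f := F) (g := 0) hz _ (h.frameArray_mem k)
    · intro hz k
      exact h.eq_on_legSpace (f := F) (g := 0) hz _ (P.legArray_mem k)
  constructor
  · intro hp
    obtain ⟨q, hq0, hq⟩ := MotionParam.exists_legForm_eq ρ
    obtain ⟨-, h2, h3, h4, -⟩ := (hp q).mp ((hL q).mpr fun k => by rw [hq0, mul_one, hq])
    rw [MotionParam.darbouxCond_iff, hq0, mul_one] at h2 h3
    rw [MotionParam.angleCond_iff, hq0, mul_one] at h4
    exact ⟨add_right_cancel (h2.trans (hq _).symm), add_right_cancel (h3.trans (hq _).symm),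
      add_right_cancel (h4.trans (hq _).symm)⟩
  · rintro ⟨rfl, rfl, rfl⟩ q
    rw [hL, hF, Fin.forall_fin_succ, Fin.forall_fin_succ, Fin.forall_fin_succ, Fin.forall_fin_succ,
      Fin.forall_fin_one, MotionParam.sphereCond_iff, MotionParam.darbouxCond_iff,
      MotionParam.darbouxCond_iff, MotionParam.angleCond_iff, MotionParam.sphereCond_iff, ← hρ j,
      ← hi]
    rfl

/-- Existence and uniqueness of the leg parameters. -/
theorem IsAdapted.existsUnique_legParams {P : Pentapod} {i j : Fin 5} {a₂ : ℂ}
    (h : P.IsAdapted i j a₂) (R : Fin 5 → ℂ) :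
    ∃! p : ℂ × ℂ × ℂ, P.LegParams i j a₂ R p.1 p.2.1 p.2.2 := by
  obtain ⟨ρ, hρ⟩ := h.exists_isLegFunctional R
  refine ⟨(ρ (P.frameArray j a₂ 1), ρ (P.frameArray j a₂ 2), ρ (P.frameArray j a₂ 3)),
    (h.legParams_iff hρ _ _ _).mpr ⟨rfl, rfl, rfl⟩, ?_⟩
  rintro ⟨p₂, p₃, w⟩ hp
  obtain ⟨h1, h2, h3⟩ := (h.legParams_iff hρ _ _ _).mp hp
  exact Prod.ext h1 (Prod.ext h2 h3)

/-- All leg parameters occur. -/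
theorem IsAdapted.exists_legParams {P : Pentapod} {i j : Fin 5} {a₂ : ℂ}
    (h : P.IsAdapted i j a₂) (p₂ p₃ w R₁ R₅ : ℂ) :
    ∃ R : Fin 5 → ℂ, R i = R₁ ∧ R j = R₅ ∧ P.LegParams i j a₂ R p₂ p₃ w := by
  obtain ⟨ρ, hρ⟩ := exists_functional (P.linearIndependent_frameArray j a₂ h.a_ne_zero)
    ![sphereConst 0 0 R₁, p₂, p₃, w, sphereConst (P.a j) (toC (P.M j)) R₅]
  -- Over ℂ every constant is a sphere constant, because R² can be any number.
  have hsq : ∀ k, ∃ S : ℂ, ρ (P.legArray k) = sphereConst (P.a k) (toC (P.M k)) S := by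
    intro k
    obtain ⟨S, hS⟩ := IsAlgClosed.exists_pow_nat_eq
      ((P.a k : ℂ) ^ 2 + toC (P.M k) 0 ^ 2 + toC (P.M k) 1 ^ 2 + toC (P.M k) 2 ^ 2 -
        2 * ρ (P.legArray k)) (n := 2) two_pos
    refine ⟨S, ?_⟩
    rw [sphereConst, hS]
    ring
  choose S hS using hsq
  have hi : ρ (P.legArray i) = sphereConst (P.a i) (toC (P.M i)) R₁ := by
    rw [h.legArray_zero, h.a_zero, h.M_zero]
    refine (hρ 0).trans ?_
    simp [sphereConst, toC]
  have hj : ρ (P.legArray j) = sphereConst (P.a j) (toC (P.M j)) R₅ := hρ 4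
  -- The lengths of legs `i` and `j` are prescribed including their sign, so the chosen roots are
  -- overwritten there.
  let R : Fin 5 → ℂ := Function.update (Function.update S i R₁) j R₅
  have hRj : R j = R₅ := Function.update_self _ _ _
  have hRi : R i = R₁ := by
    rw [show R i = Function.update S i R₁ i from Function.update_of_ne h.ne _ _,
      Function.update_self]
  have hR : P.IsLegFunctional R ρ := by
    intro k
    by_cases hkj : k = j
    · rw [hkj, hRj, hj]
    by_cases hki : k = i
    · rw [hki, hRi, hi]
    · rw [hS k, show R k = Function.update S i R₁ k from Function.update_of_ne hkj _ _,
        Function.update_of_ne hki]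
  exact ⟨R, hRi, hRj, (h.legParams_iff hR _ _ _).mpr ⟨(hρ 1).symm, (hρ 2).symm, (hρ 3).symm⟩⟩

/-- Complex conjugation of leg lengths and leg parameters. -/
theorem LegParams.conj {P : Pentapod} {i j : Fin 5} {a₂ : ℂ} {R : Fin 5 → ℂ} {p₂ p₃ w : ℂ}
    (h : P.LegParams i j a₂ R p₂ p₃ w) :
    P.LegParams i j a₂ (fun k => starRingEnd ℂ (R k)) (starRingEnd ℂ p₃) (starRingEnd ℂ p₂)
      (starRingEnd ℂ w) := by
  intro q
  -- Each condition with conjugated data at `q` is the conjugate of the original condition at `q'`;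
  -- the two Darboux conditions change places.
  let q' : MotionParam := (starRingEnd ℂ q.n₀, fun k => starRingEnd ℂ (q.x k),
    fun k => starRingEnd ℂ (q.y k))
  have hS : ∀ (a : ℂ) (M : Fin 3 → ℂ) (R : ℂ),
      q.SphereCond (starRingEnd ℂ a) (fun k => starRingEnd ℂ (M k)) (starRingEnd ℂ R) ↔
        q'.SphereCond a M R := by
    intro a M R
    rw [MotionParam.SphereCond, MotionParam.SphereCond, ← map_eq_zero (starRingEnd ℂ)]
    simp [q', MotionParam.x, MotionParam.y, MotionParam.n₀, map_ofNat]
  have hS' : ∀ (a : ℝ) (M : Fin 3 → ℝ) (R : ℂ),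
      q.SphereCond a (toC M) (starRingEnd ℂ R) ↔ q'.SphereCond a (toC M) R := by
    intro a M R
    rw [← hS, conj_ofReal]
    simp only [toC, conj_ofReal]
    rfl
  have hS0 : ∀ (R : ℂ), q.SphereCond 0 0 (starRingEnd ℂ R) ↔ q'.SphereCond 0 0 R := by
    intro R
    simpa only [toC_zero, ofReal_zero] using hS' 0 0 R
  have hDa : ∀ p a β : ℂ, q.DarbouxCond (starRingEnd ℂ p) (starRingEnd ℂ a) (starRingEnd ℂ β) ↔
      q'.DarbouxCond p a β := by
    intro p a β
    rw [MotionParam.DarbouxCond, MotionParam.DarbouxCond, ← map_eq_zero (starRingEnd ℂ)]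
    simp [q', MotionParam.x, MotionParam.y]
  have hA : q.AngleCond (starRingEnd ℂ w) ↔ q'.AngleCond w := by
    rw [MotionParam.AngleCond, MotionParam.AngleCond, ← map_eq_zero (starRingEnd ℂ)]
    simp [q', MotionParam.x]
  have h2 := hDa p₂ a₂ (-I)
  have h3 := hDa p₃ (starRingEnd ℂ a₂) I
  rw [map_neg, conj_I, neg_neg] at h2
  rw [conj_I, conj_conj] at h3
  simp only [hS', hS0, h2, h3, hA]
  rw [h q']
  tauto

end Pentapod

/-! ### Poses and isotropic coordinates -/

/-- The motion parameters of the pose with direction `x` in which the origin of the moving system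
is at `-y`. -/
noncomputable def poseOf (x y : Fin 3 → ℂ) : MotionParam :=
  ((y ⬝ᵥ y) / 8, ![1, x 0, x 1, x 2], ![x ⬝ᵥ y, y 0, y 1, y 2])

theorem isPose_poseOf (x y : Fin 3 → ℂ) : (poseOf x y).IsPose ↔ x ⬝ᵥ x = 1 := by
  simp only [MotionParam.IsPose, poseOf, MotionParam.x, MotionParam.y, MotionParam.n₀,
    dotProduct, Fin.sum_univ_three]
  simp
  constructor
  · rintro ⟨h, -⟩
    linear_combination h
  · intro h
    exact ⟨by linear_combination h, by ring⟩

theorem MotionParam.IsPose.exists_eq {q : MotionParam} (h : q.IsPose) :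
    ∃ x y : Fin 3 → ℂ, x ⬝ᵥ x = 1 ∧ q = poseOf x y := by
  obtain ⟨n, X, Y⟩ := q
  obtain ⟨h0, h1, h2, h3⟩ := h
  simp only [MotionParam.x, MotionParam.y, MotionParam.n₀] at h0 h1 h2 h3
  refine ⟨![X 1, X 2, X 3], ![Y 1, Y 2, Y 3], ?_, ?_⟩
  · simp [dotProduct, Fin.sum_univ_three]
    linear_combination h1 + (X 0 + 1) * h0
  · rw [h0] at h1 h2 h3
    refine Prod.ext ?_ (Prod.ext ?_ ?_)
    · simp [poseOf, dotProduct, Fin.sum_univ_three]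
      linear_combination -h2 / 8
    · ext k
      fin_cases k <;> simp [poseOf, h0]
    · ext k
      fin_cases k <;> simp [poseOf, dotProduct, Fin.sum_univ_three]
      linear_combination -h3

theorem sphereCond_poseOf {x : Fin 3 → ℂ} (hx : x ⬝ᵥ x = 1) (y : Fin 3 → ℂ) (a : ℂ)
    (M : Fin 3 → ℂ) (R : ℂ) : (poseOf x y).SphereCond a M R ↔
      (a • x + y + M) ⬝ᵥ (a • x + y + M) = R ^ 2 := by
  simp only [dotProduct, Fin.sum_univ_three] at hx
  simp [MotionParam.SphereCond, poseOf, MotionParam.x, MotionParam.y, MotionParam.n₀,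
    dotProduct, Fin.sum_univ_three]
  constructor
  · intro h
    linear_combination 2 * h + a ^ 2 * hx
  · intro h
    linear_combination 1 / 2 * h - 1 / 2 * a ^ 2 * hx

theorem map_ofReal_orthogonal {Q : Matrix (Fin 3) (Fin 3) ℝ} (hQ : Q.transpose * Q = 1) :
    (Q.map ((↑) : ℝ → ℂ)).transpose * Q.map ((↑) : ℝ → ℂ) = 1 := by
  have h := congrArg (fun A : Matrix (Fin 3) (Fin 3) ℝ => A.map Complex.ofRealHom) hQ
  simp only [Matrix.map_mul, Matrix.map_one _ (map_zero _) (map_one _)] at h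
  exact h

namespace Pentapod

theorem poseOf_mem_config (P : Pentapod) (R : Fin 5 → ℂ) (x y : Fin 3 → ℂ) :
    poseOf x y ∈ P.config R ↔ x ⬝ᵥ x = 1 ∧ ∀ k,
      ((P.a k : ℂ) • x + y + toC (P.M k)) ⬝ᵥ ((P.a k : ℂ) • x + y + toC (P.M k)) = R k ^ 2 := by
  rw [config, Set.mem_ofPred_eq, isPose_poseOf]
  exact and_congr_right fun hx => forall_congr' fun k => sphereCond_poseOf hx _ _ _ _

/-- The vector -y is the position of the moving origin. Moving that origin to `m i` and the fixed
one to `M i` turns y into aᵢx + y + Mᵢ before rotation. -/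
theorem poseOf_mem_config_inFrame (P : Pentapod) (i : Fin 5) {Q : Matrix (Fin 3) (Fin 3) ℝ}
    (hQ : Q.transpose * Q = 1) (R : Fin 5 → ℂ) (x y : Fin 3 → ℂ) :
    poseOf ((Q.map ((↑) : ℝ → ℂ)).mulVec x)
      ((Q.map ((↑) : ℝ → ℂ)).mulVec ((P.a i : ℂ) • x + y + toC (P.M i))) ∈
        (P.inFrame i Q).config R ↔ poseOf x y ∈ P.config R := by
  have hQc := map_ofReal_orthogonal hQ
  rw [poseOf_mem_config, poseOf_mem_config, Matrix.mulVec_dotProduct_mulVec_of_orthogonal hQc]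
  refine and_congr_right fun _ => forall_congr' fun k => ?_
  have : (((P.inFrame i Q).a k : ℝ) : ℂ) • (Q.map ((↑) : ℝ → ℂ)).mulVec x +
      (Q.map ((↑) : ℝ → ℂ)).mulVec ((P.a i : ℂ) • x + y + toC (P.M i)) +
      toC ((P.inFrame i Q).M k) =
      (Q.map ((↑) : ℝ → ℂ)).mulVec ((P.a k : ℂ) • x + y + toC (P.M k)) := by
    have hM : toC ((P.inFrame i Q).M k) =
        (Q.map ((↑) : ℝ → ℂ)).mulVec (toC (P.M k) - toC (P.M i)) := by
      rw [inFrame, ← map_ofReal_mulVec_toC]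
      congr 1
      ext s
      simp [toC]
    rw [hM, ← Matrix.mulVec_smul, ← Matrix.mulVec_add, ← Matrix.mulVec_add]
    congr 1
    simp only [inFrame, ofReal_sub, sub_smul]
    abel
  rw [this, Matrix.mulVec_dotProduct_mulVec_of_orthogonal hQc]

end Pentapod

/-- The direction of the platform in the adapted frame, in isotropic coordinates. -/
noncomputable def frameX (w ξ η : ℂ) : Fin 3 → ℂ := ![(ξ + η) / 2, I * (ξ - η) / 2, -w]

/-- The position of the platform in the adapted frame, in isotropic coordinates. -/
noncomputable def frameY (a₂ a₃ p₂ p₃ ξ η z : ℂ) : Fin 3 → ℂ :=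
  ![-(p₂ + a₂ * ξ + (p₃ + a₃ * η)) / 2, I * (p₃ + a₃ * η - (p₂ + a₂ * ξ)) / 2, z]

/-- The equations of the configuration set in the isotropic coordinates of the adapted frame. -/
def FrameEqs (a₂ a₃ a A B C p₂ p₃ w R₁ R₅ ξ η z : ℂ) : Prop :=
  ξ * η = 1 - w ^ 2 ∧
  (p₂ + a₂ * ξ) * (p₃ + a₃ * η) + z ^ 2 = R₁ ^ 2 ∧
  2 * (C - a * w) * z + ((A + I * B) * (a - a₂) - a * p₃) * ξ +
    ((A - I * B) * (a - a₃) - a * p₂) * η +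
    (a ^ 2 + A ^ 2 + B ^ 2 + C ^ 2 - R₅ ^ 2 + R₁ ^ 2 - 2 * a * C * w -
      a * (a₂ + a₃) * (1 - w ^ 2) - (A - I * B) * p₃ - (A + I * B) * p₂) = 0

/-- The third equation is the difference of the two sphere equations: y·y cancels, and the only
remaining quadratic term, a multiple of ξη, is replaced by means of the first equation. -/
theorem frameEqs_iff (a₂ a₃ a p₂ p₃ w R₁ R₅ ξ η z : ℂ) (M : Fin 3 → ℂ) :
    FrameEqs a₂ a₃ a (M 0) (M 1) (M 2) p₂ p₃ w R₁ R₅ ξ η z ↔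
      frameX w ξ η ⬝ᵥ frameX w ξ η = 1 ∧
      frameY a₂ a₃ p₂ p₃ ξ η z ⬝ᵥ frameY a₂ a₃ p₂ p₃ ξ η z = R₁ ^ 2 ∧
      (a • frameX w ξ η + frameY a₂ a₃ p₂ p₃ ξ η z + M) ⬝ᵥ
        (a • frameX w ξ η + frameY a₂ a₃ p₂ p₃ ξ η z + M) = R₅ ^ 2 := by
  have e1 : frameX w ξ η ⬝ᵥ frameX w ξ η = ξ * η + w ^ 2 := by
    simp [frameX, dotProduct, Fin.sum_univ_three]
    linear_combination (ξ - η) ^ 2 / 4 * I_mul_I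
  have e2 : frameY a₂ a₃ p₂ p₃ ξ η z ⬝ᵥ frameY a₂ a₃ p₂ p₃ ξ η z =
      (p₂ + a₂ * ξ) * (p₃ + a₃ * η) + z ^ 2 := by
    simp [frameY, dotProduct, Fin.sum_univ_three]
    linear_combination (p₃ + a₃ * η - (p₂ + a₂ * ξ)) ^ 2 / 4 * I_mul_I
  have e3 : frameX w ξ η ⬝ᵥ frameY a₂ a₃ p₂ p₃ ξ η z =
      -(ξ * (p₃ + a₃ * η) + η * (p₂ + a₂ * ξ)) / 2 - w * z := by
    simp [frameX, frameY, dotProduct, Fin.sum_univ_three]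
    linear_combination (ξ - η) * (p₃ + a₃ * η - (p₂ + a₂ * ξ)) / 4 * I_mul_I
  have e4 : (a • frameX w ξ η + frameY a₂ a₃ p₂ p₃ ξ η z + M) ⬝ᵥ
        (a • frameX w ξ η + frameY a₂ a₃ p₂ p₃ ξ η z + M) =
      a ^ 2 * (frameX w ξ η ⬝ᵥ frameX w ξ η) +
      2 * a * (frameX w ξ η ⬝ᵥ frameY a₂ a₃ p₂ p₃ ξ η z) +
      frameY a₂ a₃ p₂ p₃ ξ η z ⬝ᵥ frameY a₂ a₃ p₂ p₃ ξ η z +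
      2 * a * (frameX w ξ η ⬝ᵥ M) + 2 * (frameY a₂ a₃ p₂ p₃ ξ η z ⬝ᵥ M) + M ⬝ᵥ M := by
    simp only [dotProduct, Fin.sum_univ_three, Pi.add_apply, Pi.smul_apply, smul_eq_mul]
    ring
  rw [e4, e3, e2, e1, FrameEqs]
  simp only [frameX, frameY, dotProduct, Fin.sum_univ_three]
  simp
  constructor
  · rintro ⟨h1, h2, h3⟩
    refine ⟨by linear_combination h1, h2, ?_⟩
    linear_combination h3 + h2 + (a ^ 2 - a * (a₂ + a₃)) * h1
  · rintro ⟨h1, h2, h3⟩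
    refine ⟨by linear_combination h1, h2, ?_⟩
    linear_combination h3 - h2 - (a ^ 2 - a * (a₂ + a₃)) * h1

/-- With ξ = x₁ - ix₂ and η = x₁ + ix₂ the Darboux conditions read y₁ - iy₂ = -(p₂ + a₂ξ) and y₁ +
iy₂ = -(p₃ + a₃η), so only ξ, η and z = y₃ remain free. -/
theorem exists_frame_coordinates {x y : Fin 3 → ℂ} {a₂ a₃ p₂ p₃ w : ℂ}
    (h2 : (poseOf x y).DarbouxCond p₂ a₂ (-I)) (h3 : (poseOf x y).DarbouxCond p₃ a₃ I)
    (h4 : (poseOf x y).AngleCond w) :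
    ∃ ξ η z, x = frameX w ξ η ∧ y = frameY a₂ a₃ p₂ p₃ ξ η z := by
  simp [MotionParam.DarbouxCond, MotionParam.AngleCond, poseOf, MotionParam.x, MotionParam.y]
    at h2 h3 h4
  refine ⟨x 0 - I * x 1, x 0 + I * x 1, y 2, ?_, ?_⟩
  · ext k
    fin_cases k <;> simp [frameX]
    · linear_combination x 1 * I_mul_I
    · linear_combination h4
  · ext k
    fin_cases k <;> simp [frameY]
    · linear_combination 1 / 2 * (h2 + h3)
    · linear_combination I / 2 * (h2 - h3) + y 1 * I_mul_I

theorem conds_frame (a₂ a₃ p₂ p₃ w ξ η z : ℂ) :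
    (poseOf (frameX w ξ η) (frameY a₂ a₃ p₂ p₃ ξ η z)).DarbouxCond p₂ a₂ (-I) ∧
    (poseOf (frameX w ξ η) (frameY a₂ a₃ p₂ p₃ ξ η z)).DarbouxCond p₃ a₃ I ∧
    (poseOf (frameX w ξ η) (frameY a₂ a₃ p₂ p₃ ξ η z)).AngleCond w := by
  simp [MotionParam.DarbouxCond, MotionParam.AngleCond, poseOf, MotionParam.x, MotionParam.y,
    frameX, frameY]
  constructor
  · linear_combination (-a₂ * (ξ - η) - (p₃ + a₃ * η - (p₂ + a₂ * ξ))) / 2 * I_mul_I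
  · linear_combination (a₃ * (ξ - η) + (p₃ + a₃ * η - (p₂ + a₂ * ξ))) / 2 * I_mul_I

/-- The pose with the given coordinates in the adapted frame, in the original frame. -/
noncomputable def frameToPose (Q : Matrix (Fin 3) (Fin 3) ℝ) (α : ℂ) (t : Fin 3 → ℂ)
    (x y : Fin 3 → ℂ) : MotionParam :=
  poseOf ((Q.map ((↑) : ℝ → ℂ)).transpose.mulVec x)
    ((Q.map ((↑) : ℝ → ℂ)).transpose.mulVec y -
      α • (Q.map ((↑) : ℝ → ℂ)).transpose.mulVec x - t)

namespace Pentapod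

theorem LegParams.mem_config_iff {P : Pentapod} {i j : Fin 5} {a₂ : ℂ} {R : Fin 5 → ℂ}
    {p₂ p₃ w : ℂ} (h : P.LegParams i j a₂ R p₂ p₃ w) (q : MotionParam) :
    q ∈ P.config R ↔ ∃ ξ η z, FrameEqs a₂ (starRingEnd ℂ a₂) (P.a j) (P.M j 0) (P.M j 1) (P.M j 2)
      p₂ p₃ w (R i) (R j) ξ η z ∧
      q = poseOf (frameX w ξ η) (frameY a₂ (starRingEnd ℂ a₂) p₂ p₃ ξ η z) := by
  have h0 : ∀ x y : Fin 3 → ℂ, x ⬝ᵥ x = 1 → ((poseOf x y).SphereCond 0 0 (R i) ↔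
      y ⬝ᵥ y = R i ^ 2) := by
    intro x y hx
    rw [sphereCond_poseOf hx]
    simp
  constructor
  · rintro ⟨hq, hs⟩
    obtain ⟨x, y, hx, rfl⟩ := hq.exists_eq
    obtain ⟨h1, h2, h3, h4, h5⟩ := (h _).mp hs
    obtain ⟨ξ, η, z, rfl, rfl⟩ := exists_frame_coordinates h2 h3 h4
    refine ⟨ξ, η, z, ?_, rfl⟩
    exact (frameEqs_iff _ _ _ _ _ _ _ _ _ _ _ (toC (P.M j))).mpr
      ⟨hx, (h0 _ _ hx).mp h1, (sphereCond_poseOf hx _ _ _ _).mp h5⟩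
  · rintro ⟨ξ, η, z, he, rfl⟩
    obtain ⟨hx, h1, h5⟩ := (frameEqs_iff _ _ _ _ _ _ _ _ _ _ _ (toC (P.M j))).mp he
    obtain ⟨h2, h3, h4⟩ := conds_frame a₂ (starRingEnd ℂ a₂) p₂ p₃ w ξ η z
    exact ⟨(isPose_poseOf _ _).mpr hx, (h _).mpr
      ⟨(h0 _ _ hx).mpr h1, h2, h3, h4, (sphereCond_poseOf hx _ _ _ _).mpr h5⟩⟩

theorem mem_config_iff_frame {P : Pentapod} {i j : Fin 5} {a₂ : ℂ} {R : Fin 5 → ℂ}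
    {Q : Matrix (Fin 3) (Fin 3) ℝ} (hQ : Q.transpose * Q = 1)
    {p₂ p₃ w : ℂ} (h : (P.inFrame i Q).LegParams i j a₂ R p₂ p₃ w) (q : MotionParam) :
    q ∈ P.config R ↔ ∃ ξ η z, FrameEqs a₂ (starRingEnd ℂ a₂) ((P.inFrame i Q).a j)
      ((P.inFrame i Q).M j 0) ((P.inFrame i Q).M j 1) ((P.inFrame i Q).M j 2)
      p₂ p₃ w (R i) (R j) ξ η z ∧
      q = frameToPose Q (P.a i) (toC (P.M i)) (frameX w ξ η)
        (frameY a₂ (starRingEnd ℂ a₂) p₂ p₃ ξ η z) := by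
  have hQc := map_ofReal_orthogonal hQ
  have hQc' : Q.map ((↑) : ℝ → ℂ) * (Q.map ((↑) : ℝ → ℂ)).transpose = 1 :=
    mul_eq_one_comm.mp hQc
  have inv1 : ∀ v, (Q.map ((↑) : ℝ → ℂ)).transpose.mulVec ((Q.map ((↑) : ℝ → ℂ)).mulVec v) = v := by
    intro v
    rw [Matrix.mulVec_mulVec, hQc, Matrix.one_mulVec]
  have inv2 : ∀ v, (Q.map ((↑) : ℝ → ℂ)).mulVec ((Q.map ((↑) : ℝ → ℂ)).transpose.mulVec v) = v := by
    intro v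
    rw [Matrix.mulVec_mulVec, hQc', Matrix.one_mulVec]
  constructor
  · intro hq
    obtain ⟨x, y, hx, rfl⟩ := hq.1.exists_eq
    rw [← P.poseOf_mem_config_inFrame i hQ, h.mem_config_iff] at hq
    obtain ⟨ξ, η, z, he, heq⟩ := hq
    refine ⟨ξ, η, z, he, ?_⟩
    have hX : (Q.map ((↑) : ℝ → ℂ)).mulVec x = frameX w ξ η := by
      ext k
      have := congrFun (congrArg MotionParam.x heq) k.succ
      fin_cases k <;> exact this
    have hY : (Q.map ((↑) : ℝ → ℂ)).mulVec ((P.a i : ℂ) • x + y + toC (P.M i)) =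
        frameY a₂ (starRingEnd ℂ a₂) p₂ p₃ ξ η z := by
      ext k
      have := congrFun (congrArg MotionParam.y heq) k.succ
      fin_cases k <;> exact this
    rw [frameToPose, ← hX, ← hY, inv1, inv1]
    congr 1
    abel
  · rintro ⟨ξ, η, z, he, rfl⟩
    rw [frameToPose, ← P.poseOf_mem_config_inFrame i hQ, inv2, h.mem_config_iff]
    refine ⟨ξ, η, z, he, ?_⟩
    congr 1
    rw [← inv2 (frameY a₂ (starRingEnd ℂ a₂) p₂ p₃ ξ η z), inv1]
    congr 1
    abel

end Pentapod

/-! ### Infinitely many configurations force a trivial linear equation -/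

theorem finite_sq_eq (b : ℂ) : {z : ℂ | z ^ 2 = b}.Finite := by
  obtain ⟨r, hr⟩ := IsAlgClosed.exists_pow_nat_eq b (n := 2) two_pos
  refine (Set.toFinite {r, -r}).subset fun z hz => ?_
  have h : z ^ 2 = r ^ 2 := by rw [hr]; exact hz
  simpa using sq_eq_sq_iff_eq_or_eq_neg.mp h

theorem quartic_eq_zero {c₀ c₁ c₂ c₃ c₄ : ℂ}
    (h : {s : ℂ | c₀ + c₁ * s + c₂ * s ^ 2 + c₃ * s ^ 3 + c₄ * s ^ 4 = 0}.Infinite) :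
    c₀ = 0 ∧ c₁ = 0 ∧ c₂ = 0 ∧ c₃ = 0 ∧ c₄ = 0 := by
  open Polynomial in
  let p : ℂ[X] := C c₀ + C c₁ * X + C c₂ * X ^ 2 + C c₃ * X ^ 3 + C c₄ * X ^ 4
  have hp : p = 0 := by
    refine Polynomial.eq_zero_of_infinite_isRoot p (h.mono fun s hs => ?_)
    simpa [p, Polynomial.IsRoot] using hs
  have hc : ∀ n, p.coeff n = 0 := fun n => by rw [hp, Polynomial.coeff_zero]
  have h0 := hc 0
  have h1 := hc 1
  have h2 := hc 2
  have h3 := hc 3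
  have h4 := hc 4
  simp [p, Polynomial.coeff_X, Polynomial.coeff_X_pow, Polynomial.coeff_C] at h0 h1 h2 h3 h4
  exact ⟨h0, h1, h2, h3, h4⟩

/-- A family of points which are determined, up to the sign of the last coordinate, by the value of
`π` is infinite only if `π` takes infinitely many values. -/
theorem infinite_image_of_sq {S : Set (ℂ × ℂ × ℂ)} (hS : S.Infinite) (π : ℂ × ℂ × ℂ → ℂ)
    (f g h : ℂ → ℂ) (hf : ∀ v ∈ S, v.1 = f (π v) ∧ v.2.1 = g (π v) ∧ v.2.2 ^ 2 = h (π v)) :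
    (π '' S).Infinite := by
  intro hfin
  refine hS (Set.Finite.of_finite_fibers π hfin fun x _ => ?_)
  refine ((finite_sq_eq (h x)).image fun z => (f x, g x, z)).subset ?_
  rintro ⟨ξ, η, z⟩ ⟨hv, hx⟩
  obtain ⟨h1, h2, h3⟩ := hf _ hv
  have hx' : π (ξ, η, z) = x := hx
  rw [hx'] at h1 h2 h3
  exact ⟨z, h3, by rw [← h1, ← h2]⟩

/-- Eliminating z gives (αs s + K)² = αz²(ρ - (p + bs)p') for infinitely many s. The leading
coefficient yields αs = 0. If αz ≠ 0, the linear one yields p' = 0, and then αs = N(a - b) ≠ 0, a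
contradiction. Stated symmetrically, it serves both lines of ξη = 0. -/
theorem line_branch {αz αs K a b p p' N ρ : ℂ} (hs : αs = N * (a - b) - a * p') (hb : b ≠ 0)
    (hab : a ≠ b) (hN : N ≠ 0)
    (hinf : {s : ℂ | ∃ z, (p + b * s) * p' + z ^ 2 = ρ ∧ αz * z + αs * s + K = 0}.Infinite) :
    αz = 0 ∧ αs = 0 ∧ K = 0 := by
  have hq := quartic_eq_zero (c₀ := K ^ 2 - αz ^ 2 * (ρ - p * p'))
    (c₁ := 2 * αs * K + αz ^ 2 * b * p') (c₂ := αs ^ 2) (c₃ := 0) (c₄ := 0)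
    (hinf.mono fun s hs => by
      obtain ⟨z, h1, h2⟩ := hs
      change _ = _
      linear_combination (αs * s + K - αz * z) * h2 + αz ^ 2 * h1)
  obtain ⟨h0, h1, h2, -, -⟩ := hq
  have hαs : αs = 0 := pow_eq_zero_iff two_ne_zero |>.mp h2
  by_cases hz : αz = 0
  · refine ⟨hz, hαs, ?_⟩
    rw [hz] at h0
    exact pow_eq_zero_iff two_ne_zero |>.mp (by linear_combination h0)
  · exfalso
    rw [hαs] at h1 hs
    have hp' : p' = 0 := by simpa [hz, hb] using h1
    rw [hp'] at hs
    have : N * (a - b) = 0 := by linear_combination -hs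
    exact (mul_ne_zero hN (sub_ne_zero.mpr hab)) this

/-- As for a line, but with η = e/s and denominators cleared by s². The extreme coefficients αξ² and
αη²e² of the quartic vanish first; the cubic one then excludes αz ≠ 0. -/
theorem hyperbola_branch {αz αξ αη K a b c p q N e ρ : ℂ} (hξ : αξ = N * (a - b) - a * q)
    (hb : b ≠ 0) (hab : a ≠ b) (hN : N ≠ 0) (he : e ≠ 0)
    (hinf : {s : ℂ | ∃ η z, s * η = e ∧ (p + b * s) * (q + c * η) + z ^ 2 = ρ ∧
      αz * z + αξ * s + αη * η + K = 0}.Infinite) :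
    αz = 0 ∧ αξ = 0 ∧ αη = 0 ∧ K = 0 := by
  have hq := quartic_eq_zero (c₀ := αη ^ 2 * e ^ 2)
    (c₁ := 2 * αη * e * K + αz ^ 2 * p * c * e)
    (c₂ := 2 * αξ * αη * e + K ^ 2 - αz ^ 2 * (ρ - p * q - b * c * e))
    (c₃ := 2 * αξ * K + αz ^ 2 * b * q) (c₄ := αξ ^ 2)
    (hinf.mono fun s hs => by
      obtain ⟨η, z, h1, h2, h3⟩ := hs
      change _ = _
      subst h1
      linear_combination s ^ 2 * (αξ * s + αη * η + K - αz * z) * h3 + αz ^ 2 * s ^ 2 * h2)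
  obtain ⟨h0, h1, h2, h3, h4⟩ := hq
  have hαξ : αξ = 0 := pow_eq_zero_iff two_ne_zero |>.mp h4
  have hαη : αη = 0 := by simpa [he] using h0
  by_cases hz : αz = 0
  · refine ⟨hz, hαξ, hαη, ?_⟩
    rw [hz, hαξ] at h2
    exact pow_eq_zero_iff two_ne_zero |>.mp (by linear_combination h2)
  · exfalso
    rw [hαξ] at h3 hξ
    have hq' : q = 0 := by simpa [hz, hb] using h3
    rw [hq'] at hξ
    have : N * (a - b) = 0 := by linear_combination -hξ
    exact (mul_ne_zero hN (sub_ne_zero.mpr hab)) this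

/-- If there are infinitely many configurations then the linear equation is trivial. -/
theorem coefficients_eq_zero {a₂ p₂ p₃ w R₁ R₅ : ℂ} {a A B C : ℝ}
    (ha₂ : starRingEnd ℂ a₂ ≠ a₂) (hAB : ¬ (A = 0 ∧ B = 0))
    (hreal : p₃ = starRingEnd ℂ p₂ ∨ C ^ 2 ≠ a ^ 2)
    (hinf : {v : ℂ × ℂ × ℂ | FrameEqs a₂ (starRingEnd ℂ a₂) a A B C p₂ p₃ w R₁ R₅
      v.1 v.2.1 v.2.2}.Infinite) :
    2 * (C - a * w) = 0 ∧ (A + I * B) * (a - a₂) - a * p₃ = 0 ∧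
      (A - I * B) * (a - starRingEnd ℂ a₂) - a * p₂ = 0 ∧
      ((a : ℂ) ^ 2 + A ^ 2 + B ^ 2 + C ^ 2 - R₅ ^ 2 + R₁ ^ 2 - 2 * a * C * w -
        a * (a₂ + starRingEnd ℂ a₂) * (1 - w ^ 2) - (A - I * B) * p₃ - (A + I * B) * p₂) = 0 := by
  have hb : a₂ ≠ 0 := by rintro rfl; simp at ha₂
  have hc : starRingEnd ℂ a₂ ≠ 0 := by simpa using hb
  have hab : (a : ℂ) ≠ a₂ := by rintro rfl; simp at ha₂
  have hac : (a : ℂ) ≠ starRingEnd ℂ a₂ := by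
    intro h
    exact hab (by rw [← conj_ofReal, h, conj_conj])
  have hN : (A + I * B : ℂ) ≠ 0 := by
    intro h
    exact hAB ⟨by simpa using congrArg re h, by simpa using congrArg im h⟩
  have hN' : (A - I * B : ℂ) ≠ 0 := by
    intro h
    exact hAB ⟨by simpa using congrArg re h, by simpa using congrArg im h⟩
  by_cases he : 1 - w ^ 2 = 0
  · -- the hyperbola degenerates to a pair of lines
    -- From C = aw and w² = 1 follows C² = a², so the reality alternative must hold.
    have hconj : 2 * ((C : ℂ) - a * w) = 0 → p₃ = starRingEnd ℂ p₂ := by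
      intro hz
      refine hreal.resolve_right fun h => h ?_
      have h1 : (C : ℂ) = a * w := sub_eq_zero.mp (by simpa using hz)
      have h2 : (C : ℂ) ^ 2 = (a : ℂ) ^ 2 := by
        rw [h1]; linear_combination -(a : ℂ) ^ 2 * he
      exact_mod_cast h2
    have hsplit : {v : ℂ × ℂ × ℂ | FrameEqs a₂ (starRingEnd ℂ a₂) a A B C p₂ p₃ w R₁ R₅
        v.1 v.2.1 v.2.2} ⊆
        {v | FrameEqs a₂ (starRingEnd ℂ a₂) a A B C p₂ p₃ w R₁ R₅ v.1 v.2.1 v.2.2 ∧ v.2.1 = 0} ∪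
        {v | FrameEqs a₂ (starRingEnd ℂ a₂) a A B C p₂ p₃ w R₁ R₅ v.1 v.2.1 v.2.2 ∧ v.1 = 0} := by
      intro v hv
      have h1 := hv.1
      rw [he] at h1
      rcases mul_eq_zero.mp h1 with h | h
      · exact Or.inr ⟨hv, h⟩
      · exact Or.inl ⟨hv, h⟩
    rcases Set.infinite_union.mp (hinf.mono hsplit) with h | h
    · have himg := infinite_image_of_sq h (fun v => v.1) id (fun _ => 0)
        (fun s => R₁ ^ 2 - (p₂ + a₂ * s) * p₃) (by
          rintro ⟨ξ, η, z⟩ ⟨⟨-, h2, -⟩, h0⟩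
          dsimp only at h0 h2 ⊢
          subst h0
          exact ⟨rfl, rfl, by linear_combination h2⟩)
      obtain ⟨hz, hξ, hK⟩ := line_branch (αz := 2 * (C - a * w)) (p := p₂) (p' := p₃) (ρ := R₁ ^ 2)
        (K := (a : ℂ) ^ 2 + A ^ 2 + B ^ 2 + C ^ 2 - R₅ ^ 2 + R₁ ^ 2 - 2 * a * C * w -
          a * (a₂ + starRingEnd ℂ a₂) * (1 - w ^ 2) - (A - I * B) * p₃ - (A + I * B) * p₂)
        rfl hb hab hN (himg.mono (by
        rintro _ ⟨⟨ξ, η, z⟩, ⟨⟨-, h2, h3⟩, h0⟩, rfl⟩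
        dsimp only at h0 h2 h3 ⊢
        subst h0
        exact ⟨z, by linear_combination h2, by linear_combination h3⟩))
      refine ⟨hz, hξ, ?_, hK⟩
      -- On this line the coefficient of η is invisible; it is the conjugate of the coefficient of
      -- ξ.
      have := congrArg (starRingEnd ℂ) hξ
      rw [hconj hz] at this
      simpa [sub_eq_add_neg] using this
    · have himg := infinite_image_of_sq h (fun v => v.2.1) (fun _ => 0) id
        (fun s => R₁ ^ 2 - (p₃ + starRingEnd ℂ a₂ * s) * p₂) (by
          rintro ⟨ξ, η, z⟩ ⟨⟨-, h2, -⟩, h0⟩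
          dsimp only at h0 h2 ⊢
          subst h0
          exact ⟨rfl, rfl, by linear_combination h2⟩)
      obtain ⟨hz, hη, hK⟩ := line_branch (αz := 2 * (C - a * w)) (p := p₃) (p' := p₂) (ρ := R₁ ^ 2)
        (K := (a : ℂ) ^ 2 + A ^ 2 + B ^ 2 + C ^ 2 - R₅ ^ 2 + R₁ ^ 2 - 2 * a * C * w -
          a * (a₂ + starRingEnd ℂ a₂) * (1 - w ^ 2) - (A - I * B) * p₃ - (A + I * B) * p₂)
        rfl hc hac hN' (himg.mono (by
        rintro _ ⟨⟨ξ, η, z⟩, ⟨⟨-, h2, h3⟩, h0⟩, rfl⟩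
        dsimp only at h0 h2 h3 ⊢
        subst h0
        exact ⟨z, by linear_combination h2, by linear_combination h3⟩))
      refine ⟨hz, ?_, hη, hK⟩
      have := congrArg (starRingEnd ℂ) hη
      rw [hconj hz]
      simpa [sub_eq_add_neg] using this
  · have himg := infinite_image_of_sq hinf (fun v => v.1) id (fun s => (1 - w ^ 2) / s)
      (fun s => R₁ ^ 2 - (p₂ + a₂ * s) * (p₃ + starRingEnd ℂ a₂ * ((1 - w ^ 2) / s))) (by
        rintro ⟨ξ, η, z⟩ ⟨h1, h2, -⟩
        dsimp only at h1 h2 ⊢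
        -- Here 1 - w² ≠ 0, so ξ parametrizes the hyperbola.
        have hξ : ξ ≠ 0 := by
          rintro rfl
          exact he (by rw [← h1, zero_mul])
        have hη : η = (1 - w ^ 2) / ξ := by rw [← h1]; field_simp
        exact ⟨rfl, hη, by rw [← hη]; linear_combination h2⟩)
    exact hyperbola_branch rfl hb hab hN he (himg.mono (by
      rintro _ ⟨⟨ξ, η, z⟩, ⟨h1, h2, h3⟩, rfl⟩
      exact ⟨η, z, h1, h2, h3⟩))

/-! ### Construction of self-motions and the dimension bound -/

/-- The arc has a connected image with at least two points. -/
theorem HasSelfMotion.infinite {S : Set MotionParam} (h : HasSelfMotion S) : S.Infinite := by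
  obtain ⟨γ, hγ, hS, s, hs, hne⟩ := h
  have hpre : IsPreconnected (γ '' Metric.ball 0 1) :=
    (convex_ball (0 : ℂ) 1).isPreconnected.image _ hγ.continuousOn
  refine (hpre.infinite_of_nontrivial ⟨γ s, ⟨s, hs, rfl⟩, γ 0, ⟨0, by simp, rfl⟩, hne⟩).mono ?_
  rintro _ ⟨t, ht, rfl⟩
  exact hS t ht

/-- Holomorphic square roots exist locally near some point of the punctured plane. -/
theorem exists_sqrt_on_ball {g : ℂ → ℂ} (hg : DifferentiableOn ℂ g {0}ᶜ) :
    ∃ (s₀ : ℂ) (r : ℝ) (f : ℂ → ℂ), 0 < r ∧ Metric.ball s₀ r ⊆ {0}ᶜ ∧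
      DifferentiableOn ℂ f (Metric.ball s₀ r) ∧ ∀ s ∈ Metric.ball s₀ r, f s ^ 2 = g s := by
  by_cases h : ∀ s, s ≠ 0 → g s = 0
  · refine ⟨1, 1, fun _ => 0, one_pos, ?_, differentiableOn_const 0, ?_⟩
    · rintro s hs rfl
      simp at hs
    · intro s hs
      rw [h s (by rintro rfl; simp at hs)]
      simp
  · push Not at h
    obtain ⟨s₀, hs₀, hgs⟩ := h
    have hopen : IsOpen ({0}ᶜ : Set ℂ) := isOpen_compl_singleton
    -- Dividing by g(s₀) brings the values near 1, where the principal branch of the root is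
    -- holomorphic; a root of g(s₀) is multiplied back afterwards.
    have hcont : ContinuousAt (fun s => g s / g s₀) s₀ :=
      (hg.continuousOn.continuousAt (hopen.mem_nhds hs₀)).div_const _
    have h1 : ∀ᶠ s in nhds s₀, g s / g s₀ ∈ slitPlane :=
      hcont.eventually (isOpen_slitPlane.mem_nhds (by
        dsimp only; rw [div_self hgs]; exact one_mem_slitPlane))
    obtain ⟨r, hr, hb⟩ := Metric.eventually_nhds_iff_ball.mp (h1.and (hopen.mem_nhds hs₀))
    obtain ⟨c, hc⟩ := IsAlgClosed.exists_pow_nat_eq (g s₀) (n := 2) two_pos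
    refine ⟨s₀, r, fun s => c * (g s / g s₀) ^ (1 / 2 : ℂ), hr, fun s hs => (hb s hs).2, ?_, ?_⟩
    · have hgb : DifferentiableOn ℂ g (Metric.ball s₀ r) := hg.mono fun s hs => (hb s hs).2
      exact ((hgb.div_const _).cpow_const fun s hs => (hb s hs).1).const_mul c
    · intro s hs
      dsimp only
      rw [mul_pow, hc, ← cpow_nat_mul]
      norm_num
      field_simp

theorem DifferentiableOn.poseOf {x y : ℂ → Fin 3 → ℂ} {s : Set ℂ}
    (hx : ∀ k, DifferentiableOn ℂ (fun t => x t k) s)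
    (hy : ∀ k, DifferentiableOn ℂ (fun t => y t k) s) :
    DifferentiableOn ℂ (fun t => poseOf (x t) (y t)) s := by
  unfold _root_.poseOf
  have hd : ∀ {u v : ℂ → Fin 3 → ℂ}, (∀ k, DifferentiableOn ℂ (fun t => u t k) s) →
      (∀ k, DifferentiableOn ℂ (fun t => v t k) s) →
      DifferentiableOn ℂ (fun t => u t ⬝ᵥ v t) s := by
    intro u v hu hv
    simp only [dotProduct, Fin.sum_univ_three]
    exact (((hu 0).mul (hv 0)).add ((hu 1).mul (hv 1))).add ((hu 2).mul (hv 2))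
  refine ((hd hy hy).div_const 8).prodMk (DifferentiableOn.prodMk ?_ ?_)
  · rw [differentiableOn_pi]
    intro k
    fin_cases k
    · exact differentiableOn_const _
    · exact hx 0
    · exact hx 1
    · exact hx 2
  · rw [differentiableOn_pi]
    intro k
    fin_cases k
    · exact hd hx hy
    · exact hy 0
    · exact hy 1
    · exact hy 2

theorem DifferentiableOn.frameToPose {x y : ℂ → Fin 3 → ℂ} {s : Set ℂ}
    (Q : Matrix (Fin 3) (Fin 3) ℝ) (α : ℂ) (v : Fin 3 → ℂ)
    (hx : ∀ k, DifferentiableOn ℂ (fun t => x t k) s)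
    (hy : ∀ k, DifferentiableOn ℂ (fun t => y t k) s) :
    DifferentiableOn ℂ (fun t => frameToPose Q α v (x t) (y t)) s := by
  have hm : ∀ {u : ℂ → Fin 3 → ℂ}, (∀ k, DifferentiableOn ℂ (fun t => u t k) s) →
      ∀ k, DifferentiableOn ℂ
        (fun t => (Q.map ((↑) : ℝ → ℂ)).transpose.mulVec (u t) k) s := by
    intro u hu k
    simp only [Matrix.mulVec, dotProduct, Fin.sum_univ_three]
    exact (((hu 0).const_mul _).add ((hu 1).const_mul _)).add ((hu 2).const_mul _)
  refine DifferentiableOn.poseOf (hm hx) fun k => ?_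
  exact ((hm hy k).sub ((hm hx k).const_mul α)).sub (differentiableOn_const _)

/-- The direction of the platform with respect to the rotated frame. -/
noncomputable def frameDir (Q : Matrix (Fin 3) (Fin 3) ℝ) (k : Fin 3) : MotionParam →ₗ[ℂ] ℂ where
  toFun q := (Q k 0 : ℂ) * q.2.1 1 + Q k 1 * q.2.1 2 + Q k 2 * q.2.1 3
  map_add' q q' := by simp only [Prod.snd_add, Prod.fst_add, Pi.add_apply]; ring
  map_smul' c q := by
    simp only [Prod.smul_snd, Prod.smul_fst, Pi.smul_apply, smul_eq_mul, RingHom.id_apply]; ring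

theorem frameDir_frameToPose {Q : Matrix (Fin 3) (Fin 3) ℝ} (hQ : Q.transpose * Q = 1) (α : ℂ)
    (v x y : Fin 3 → ℂ) (k : Fin 3) : frameDir Q k (frameToPose Q α v x y) = x k := by
  have hQc' : Q.map ((↑) : ℝ → ℂ) * (Q.map ((↑) : ℝ → ℂ)).transpose = 1 :=
    mul_eq_one_comm.mp (map_ofReal_orthogonal hQ)
  have h := congrFun (show (Q.map ((↑) : ℝ → ℂ)).mulVec
    ((Q.map ((↑) : ℝ → ℂ)).transpose.mulVec x) = x by
      rw [Matrix.mulVec_mulVec, hQc', Matrix.one_mulVec]) k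
  rw [← h]
  conv_rhs => rw [Matrix.mulVec, dotProduct, Fin.sum_univ_three]
  rfl

/-- A self-motion exists if the linear equation is trivial. -/
theorem hasSelfMotion_of_coefficients {S : Set MotionParam} {Q : Matrix (Fin 3) (Fin 3) ℝ}
    (hQ : Q.transpose * Q = 1) (α : ℂ) (v : Fin 3 → ℂ) (a₂ a₃ p₂ p₃ w ρ : ℂ)
    (hS : ∀ ξ η z, ξ * η = 1 - w ^ 2 → (p₂ + a₂ * ξ) * (p₃ + a₃ * η) + z ^ 2 = ρ →
      frameToPose Q α v (frameX w ξ η) (frameY a₂ a₃ p₂ p₃ ξ η z) ∈ S) : HasSelfMotion S := by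
  have hinv : DifferentiableOn ℂ (fun s : ℂ => (1 - w ^ 2) / s) {0}ᶜ :=
    (differentiableOn_const _).div differentiableOn_id fun s hs => hs
  have hid : ∀ {T : Set ℂ}, DifferentiableOn ℂ (fun s : ℂ => s) T := differentiableOn_id
  -- The arc is ξ = s, η = (1 - w²)/s, with z a local square root solving the second equation.
  obtain ⟨s₀, r, f, hr, hball, hf, hfg⟩ := exists_sqrt_on_ball
    (g := fun s => ρ - (p₂ + a₂ * s) * (p₃ + a₃ * ((1 - w ^ 2) / s)))
    (((hid.const_mul a₂).const_add p₂).mul ((hinv.const_mul a₃).const_add p₃) |>.const_sub ρ)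
  have hinv' := hinv.mono hball
  have hΓ : DifferentiableOn ℂ (fun s => frameToPose Q α v (frameX w s ((1 - w ^ 2) / s))
      (frameY a₂ a₃ p₂ p₃ s ((1 - w ^ 2) / s) (f s))) (Metric.ball s₀ r) := by
    have h2 := (hid (T := Metric.ball s₀ r)).const_mul a₂ |>.const_add p₂
    have h3 := (hinv'.const_mul a₃).const_add p₃
    refine DifferentiableOn.frameToPose Q α v (fun k => ?_) (fun k => ?_)
    · fin_cases k
      · exact (hid.add hinv').div_const 2
      · exact ((hid.sub hinv').const_mul I).div_const 2
      · exact differentiableOn_const _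
    · fin_cases k
      · exact (h2.add h3).neg.div_const 2
      · exact ((h3.sub h2).const_mul I).div_const 2
      · exact hf
  have hmaps : Set.MapsTo (fun t : ℂ => s₀ + r * t) (Metric.ball 0 1) (Metric.ball s₀ r) := by
    intro t ht
    rw [mem_ball_zero_iff] at ht
    simp only [Metric.mem_ball, dist_eq_norm, add_sub_cancel_left, norm_mul, norm_real,
      Real.norm_eq_abs, abs_of_pos hr]
    nlinarith
  have hlin : DifferentiableOn ℂ (fun t : ℂ => s₀ + r * t) (Metric.ball 0 1) :=
    (hid.const_mul _).const_add _
  refine ⟨_, (hΓ.comp hlin hmaps).analyticOnNhd Metric.isOpen_ball, ?_, 1 / 2, ?_, ?_⟩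
  · intro t ht
    have hm := hmaps ht
    refine hS _ _ _ (mul_div_cancel₀ _ (hball hm)) ?_
    rw [hfg _ hm]
    ring
  · simp; norm_num
  · intro heq
    -- The first two direction coordinates together recover ξ, which takes different values at the
    -- two parameters.
    have h0 := congrArg (frameDir Q 0) heq
    have h1 := congrArg (frameDir Q 1) heq
    simp only [Function.comp_apply, frameDir_frameToPose hQ] at h0 h1
    simp [frameX] at h0 h1
    have : (r : ℂ) = 0 := by linear_combination h0 + h1
    exact hr.ne' (ofReal_eq_zero.mp this)

/-- The projection is (ξ + η)/2: its value leaves a quadratic equation for ξ, then η is determined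
and z is known up to sign. Projecting to ξ alone could give infinite fibres when w² = 1. -/
theorem dimLEOne_of_frame {S : Set MotionParam} {Q : Matrix (Fin 3) (Fin 3) ℝ}
    (hQ : Q.transpose * Q = 1) (α : ℂ) (v : Fin 3 → ℂ) (a₂ a₃ p₂ p₃ w ρ : ℂ)
    (hS : ∀ q ∈ S, ∃ ξ η z, ξ * η = 1 - w ^ 2 ∧ (p₂ + a₂ * ξ) * (p₃ + a₃ * η) + z ^ 2 = ρ ∧
      q = frameToPose Q α v (frameX w ξ η) (frameY a₂ a₃ p₂ p₃ ξ η z)) : DimLEOne S := by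
  refine ⟨frameDir Q 0, fun c => ?_⟩
  have hξ : {ξ : ℂ | ξ * (2 * c - ξ) = 1 - w ^ 2}.Finite := by
    refine ((finite_sq_eq (c ^ 2 - (1 - w ^ 2))).image fun t => t + c).subset fun ξ hξ => ?_
    refine ⟨ξ - c, ?_, by simp⟩
    change _ = _ at hξ ⊢
    linear_combination -hξ
  refine (hξ.biUnion fun ξ _ =>
    ((finite_sq_eq (ρ - (p₂ + a₂ * ξ) * (p₃ + a₃ * (2 * c - ξ)))).image fun z =>
      frameToPose Q α v (frameX w ξ (2 * c - ξ)) (frameY a₂ a₃ p₂ p₃ ξ (2 * c - ξ) z))).subset ?_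
  rintro q ⟨hq, hc⟩
  obtain ⟨ξ, η, z, h1, h2, rfl⟩ := hS q hq
  rw [frameDir_frameToPose hQ] at hc
  have hη : η = 2 * c - ξ := by
    simp [frameX] at hc
    linear_combination 2 * hc
  subst hη
  simp only [Set.mem_iUnion]
  exact ⟨ξ, h1, z, by change _ = _; linear_combination h2, rfl⟩

/-! ### Special leg parameters and the theorem -/

/-- The linear equation of the configuration set is trivial exactly for the special leg
parameters. -/
theorem coefficients_eq_zero_iff {a₂ a₃ a A B C p₂ p₃ w R₁ R₅ : ℂ} (ha : a ≠ 0) :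
    (2 * (C - a * w) = 0 ∧ (A + I * B) * (a - a₂) - a * p₃ = 0 ∧
      (A - I * B) * (a - a₃) - a * p₂ = 0 ∧
      (a ^ 2 + A ^ 2 + B ^ 2 + C ^ 2 - R₅ ^ 2 + R₁ ^ 2 - 2 * a * C * w -
        a * (a₂ + a₃) * (1 - w ^ 2) - (A - I * B) * p₃ - (A + I * B) * p₂) = 0) ↔
    (w = C / a ∧ p₂ = -((a₃ - a) * (A - I * B)) / a ∧ p₃ = -((a₂ - a) * (A + I * B)) / a ∧
      (A ^ 2 + B ^ 2 + C ^ 2) * (a₂ + a₃ - a) +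
        (R₁ ^ 2 - R₅ ^ 2 - a₂ * a - a₃ * a + a ^ 2) * a = 0) := by
  -- Once the coefficients of z, ξ, η vanish, the relation between the two leg lengths is a times
  -- the constant term.
  have key : C = a * w → a * p₂ = (A - I * B) * (a - a₃) → a * p₃ = (A + I * B) * (a - a₂) →
      (A ^ 2 + B ^ 2 + C ^ 2) * (a₂ + a₃ - a) +
        (R₁ ^ 2 - R₅ ^ 2 - a₂ * a - a₃ * a + a ^ 2) * a =
      a * (a ^ 2 + A ^ 2 + B ^ 2 + C ^ 2 - R₅ ^ 2 + R₁ ^ 2 - 2 * a * C * w -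
        a * (a₂ + a₃) * (1 - w ^ 2) - (A - I * B) * p₃ - (A + I * B) * p₂) := by
    intro hC h2 h3
    subst hC
    linear_combination (A - I * B) * h3 + (A + I * B) * h2 +
      B ^ 2 * (a₂ + a₃ - 2 * a) * I_mul_I
  constructor
  · rintro ⟨h1, h3, h2, h4⟩
    have hC : C = a * w := by linear_combination h1 / 2
    have h2' : a * p₂ = (A - I * B) * (a - a₃) := by linear_combination -h2
    have h3' : a * p₃ = (A + I * B) * (a - a₂) := by linear_combination -h3
    refine ⟨?_, ?_, ?_, ?_⟩
    · rw [eq_div_iff ha]; linear_combination -hC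
    · rw [eq_div_iff ha]; linear_combination h2'
    · rw [eq_div_iff ha]; linear_combination h3'
    · rw [key hC h2' h3', h4, mul_zero]
  · rintro ⟨h1, h2, h3, h4⟩
    rw [eq_div_iff ha] at h1 h2 h3
    have hC : C = a * w := by linear_combination -h1
    have h2' : a * p₂ = (A - I * B) * (a - a₃) := by linear_combination h2
    have h3' : a * p₃ = (A + I * B) * (a - a₂) := by linear_combination h3
    refine ⟨?_, ?_, ?_, ?_⟩
    · linear_combination 2 * hC
    · linear_combination -h3'
    · linear_combination -h2'
    · rw [key hC h2' h3'] at h4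
      exact (mul_eq_zero.mp h4).resolve_left ha

namespace Pentapod

variable {P : Pentapod} {i j : Fin 5} {a₂ : ℂ}

theorem IsAdapted.legParams_unique (h : P.IsAdapted i j a₂) {R : Fin 5 → ℂ}
    {p₂ p₃ w p₂' p₃' w' : ℂ} (hp : P.LegParams i j a₂ R p₂ p₃ w)
    (hp' : P.LegParams i j a₂ R p₂' p₃' w') : p₂ = p₂' ∧ p₃ = p₃' ∧ w = w' := by
  obtain ⟨ρ, hρ⟩ := h.exists_isLegFunctional R
  obtain ⟨h1, h2, h3⟩ := (h.legParams_iff hρ _ _ _).mp hp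
  obtain ⟨h1', h2', h3'⟩ := (h.legParams_iff hρ _ _ _).mp hp'
  exact ⟨h1.trans h1'.symm, h2.trans h2'.symm, h3.trans h3'.symm⟩

theorem LegParams.congr_sq {R S : Fin 5 → ℂ} {p₂ p₃ w : ℂ} (h : P.LegParams i j a₂ R p₂ p₃ w)
    (hRS : ∀ k, R k ^ 2 = S k ^ 2) : P.LegParams i j a₂ S p₂ p₃ w := by
  intro q
  have hS : ∀ k a M, q.SphereCond a M (S k) ↔ q.SphereCond a M (R k) := by
    intro k a M
    rw [MotionParam.SphereCond, MotionParam.SphereCond, hRS k]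
  simp only [hS]
  exact h q

theorem conj_sq_eq_of_im {z : ℂ} (hz : (z ^ 2).im = 0) : z ^ 2 = (starRingEnd ℂ z) ^ 2 := by
  rw [← map_pow, eq_comm]
  exact conj_eq_iff_im.mpr hz

/-- With real squares, conjugation leaves the system of legs unchanged but exchanges and conjugates
p₂ and p₃; uniqueness does the rest. -/
theorem IsAdapted.p₃_eq_conj (h : P.IsAdapted i j a₂) {R : Fin 5 → ℂ} {p₂ p₃ w : ℂ}
    (hp : P.LegParams i j a₂ R p₂ p₃ w) (hR : ∀ k, ((R k) ^ 2).im = 0) :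
    p₃ = starRingEnd ℂ p₂ :=
  (h.legParams_unique (hp.congr_sq fun k => conj_sq_eq_of_im (hR k)) hp.conj).2.1

/-- Two systems of leg lengths have the same leg parameters and the same difference of squared
lengths of the legs `i`, `j` if and only if all differences of squared lengths agree. -/
theorem IsAdapted.legParams_eq_iff (h : P.IsAdapted i j a₂) {R S : Fin 5 → ℂ}
    {p₂ p₃ w p₂' p₃' w' : ℂ} (hp : P.LegParams i j a₂ R p₂ p₃ w)
    (hp' : P.LegParams i j a₂ S p₂' p₃' w') :
    (p₂ = p₂' ∧ p₃ = p₃' ∧ w = w' ∧ R i ^ 2 - R j ^ 2 = S i ^ 2 - S j ^ 2) ↔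
      ∀ k l, R k ^ 2 - R l ^ 2 = S k ^ 2 - S l ^ 2 := by
  obtain ⟨ρ, hρ⟩ := h.exists_isLegFunctional R
  obtain ⟨σ, hσ⟩ := h.exists_isLegFunctional S
  obtain ⟨h1, h2, h3⟩ := (h.legParams_iff hρ _ _ _).mp hp
  obtain ⟨h1', h2', h3'⟩ := (h.legParams_iff hσ _ _ _).mp hp'
  -- The entry δ at (0, 0) is 1 on every leg and 0 on arrays with an ideal base point. A common
  -- shift of all squared lengths therefore changes the functional by τδ and leaves p₂, p₃, w fixed.
  let τ : ℂ := (S i ^ 2 - R i ^ 2) / 2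
  let δ : Matrix (Fin 2) (Fin 4) ℂ →ₗ[ℂ] ℂ :=
    { toFun := fun T => T 0 0, map_add' := fun _ _ => rfl, map_smul' := fun _ _ => rfl }
  have hδ : ∀ k, δ (P.legArray k) = 1 := by
    intro k
    change P.legArray k 0 0 = 1
    simp [legArray, platformPt, basePt]
  have hleg : ∀ k, ρ (P.legArray k) - σ (P.legArray k) = (S k ^ 2 - R k ^ 2) / 2 := by
    intro k
    rw [hρ k, hσ k, sphereConst, sphereConst]
    ring
  constructor
  · rintro ⟨rfl, rfl, rfl, hd⟩
    have hf : ∀ k, ρ (P.frameArray j a₂ k) = (σ + τ • δ) (P.frameArray j a₂ k) := by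
      intro k
      rw [LinearMap.add_apply, LinearMap.smul_apply, smul_eq_mul]
      fin_cases k
      · have := hleg i
        have hd := hδ i
        rw [h.legArray_zero] at this hd
        change ρ (Matrix.vecMulVec _ _) = σ (Matrix.vecMulVec _ _) + τ * δ (Matrix.vecMulVec _ _)
        rw [hd]
        simp only [τ]
        linear_combination this
      · have h0 : δ (P.frameArray j a₂ 1) = 0 := by
          change P.frameArray j a₂ 1 0 0 = 0
          simp [frameArray, idealPt]
        change ρ (P.frameArray j a₂ 1) = σ (P.frameArray j a₂ 1) + τ * δ (P.frameArray j a₂ 1)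
        rw [h0, ← h1, ← h1', mul_zero, add_zero]
      · have h0 : δ (P.frameArray j a₂ 2) = 0 := by
          change P.frameArray j a₂ 2 0 0 = 0
          simp [frameArray, idealPt]
        change ρ (P.frameArray j a₂ 2) = σ (P.frameArray j a₂ 2) + τ * δ (P.frameArray j a₂ 2)
        rw [h0, ← h2, ← h2', mul_zero, add_zero]
      · have h0 : δ (P.frameArray j a₂ 3) = 0 := by
          change P.frameArray j a₂ 3 0 0 = 0
          simp [frameArray, idealPt]
        change ρ (P.frameArray j a₂ 3) = σ (P.frameArray j a₂ 3) + τ * δ (P.frameArray j a₂ 3)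
        rw [h0, ← h3, ← h3', mul_zero, add_zero]
      · change ρ (P.legArray j) = σ (P.legArray j) + τ * δ (P.legArray j)
        rw [hδ j]
        simp only [τ]
        linear_combination hleg j + hd / 2
    have hall : ∀ k, S k ^ 2 - R k ^ 2 = 2 * τ := by
      intro k
      have := h.eq_on_legSpace hf _ (P.legArray_mem k)
      rw [LinearMap.add_apply, LinearMap.smul_apply, smul_eq_mul, hδ k] at this
      linear_combination 2 * this - 2 * hleg k
    intro k l
    linear_combination hall l - hall k
  · intro hd
    have hl : ∀ k, ρ (P.legArray k) = (σ + τ • δ) (P.legArray k) := by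
      intro k
      rw [LinearMap.add_apply, LinearMap.smul_apply, smul_eq_mul, hδ k]
      simp only [τ]
      linear_combination hleg k - hd k i / 2
    have hf := fun k => P.eq_on_legSpace_of_legs hl _ (h.frameArray_mem k)
    have hz : ∀ k : Fin 5, P.frameArray j a₂ k 0 0 = 0 →
        ρ (P.frameArray j a₂ k) = σ (P.frameArray j a₂ k) := by
      intro k hk
      have := hf k
      rwa [LinearMap.add_apply, LinearMap.smul_apply, show δ (P.frameArray j a₂ k) = 0 from hk,
        smul_zero, add_zero] at this
    refine ⟨?_, ?_, ?_, hd i j⟩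
    · rw [h1, h1', hz 1 (by simp [frameArray, idealPt])]
    · rw [h2, h2', hz 2 (by simp [frameArray, idealPt])]
    · rw [h3, h3', hz 3 (by simp [frameArray, idealPt])]

theorem hasSelfMotion_iff {P : Pentapod} {i j : Fin 5} {a₂ : ℂ} {Q : Matrix (Fin 3) (Fin 3) ℝ}
    (hQ : Q.transpose * Q = 1) (h : (P.inFrame i Q).IsAdapted i j a₂) {R : Fin 5 → ℂ}
    {p₂ p₃ w : ℂ} (hp : (P.inFrame i Q).LegParams i j a₂ R p₂ p₃ w) {a A B C : ℝ}
    (ha : (P.inFrame i Q).a j = a) (hM : (P.inFrame i Q).M j = ![A, B, C])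
    (hR : (∀ k, ((R k) ^ 2).im = 0) ∨ C ^ 2 ≠ a ^ 2) :
    HasSelfMotion (P.config R) ↔
      w = C / a ∧
      p₂ = -((starRingEnd ℂ a₂ - a) * (A - I * B)) / a ∧
      p₃ = -((a₂ - a) * (A + I * B)) / a ∧
      ((A : ℂ) ^ 2 + B ^ 2 + C ^ 2) * (a₂ + starRingEnd ℂ a₂ - a) +
        (R i ^ 2 - R j ^ 2 - a₂ * a - starRingEnd ℂ a₂ * a + a ^ 2) * a = 0 := by
  have ha0 : (a : ℂ) ≠ 0 := by
    have := h.a_ne_zero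
    rw [ha] at this
    exact ofReal_ne_zero.mpr this
  have hcfg := fun q => mem_config_iff_frame hQ hp q
  simp only [ha, hM, Matrix.cons_val_zero, Matrix.cons_val_one, Matrix.cons_val] at hcfg
  rw [← coefficients_eq_zero_iff ha0]
  constructor
  · intro hS
    refine coefficients_eq_zero h.conj_ne ?_ (hR.imp_left (h.p₃_eq_conj hp)) ?_
    · have := h.not_axis
      rw [hM] at this
      exact this
    · have himg := hS.infinite.mono (t := (fun v : ℂ × ℂ × ℂ =>
        frameToPose Q (P.a i) (toC (P.M i)) (frameX w v.1 v.2.1)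
          (frameY a₂ (starRingEnd ℂ a₂) p₂ p₃ v.1 v.2.1 v.2.2)) ''
        {v : ℂ × ℂ × ℂ | FrameEqs a₂ (starRingEnd ℂ a₂) a A B C p₂ p₃ w (R i) (R j)
          v.1 v.2.1 v.2.2}) (by
        intro q hq
        obtain ⟨ξ, η, z, he, rfl⟩ := (hcfg q).mp hq
        exact ⟨(ξ, η, z), he, rfl⟩)
      exact himg.of_image _
  · rintro ⟨h1, h2, h3, h4⟩
    refine hasSelfMotion_of_coefficients hQ (P.a i) (toC (P.M i)) a₂ (starRingEnd ℂ a₂) p₂ p₃ w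
      (R i ^ 2) fun ξ η z he hz => (hcfg _).mpr ⟨ξ, η, z, ⟨he, hz, ?_⟩, rfl⟩
    rw [h1, h2, h3, h4]
    ring

theorem dimLEOne_config {P : Pentapod} {i j : Fin 5} {a₂ : ℂ} {Q : Matrix (Fin 3) (Fin 3) ℝ}
    (hQ : Q.transpose * Q = 1) (h : (P.inFrame i Q).IsAdapted i j a₂) (R : Fin 5 → ℂ) :
    DimLEOne (P.config R) := by
  obtain ⟨⟨p₂, p₃, w⟩, hp, -⟩ := h.existsUnique_legParams R
  refine dimLEOne_of_frame hQ (P.a i) (toC (P.M i)) a₂ (starRingEnd ℂ a₂) p₂ p₃ w (R i ^ 2) ?_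
  intro q hq
  obtain ⟨ξ, η, z, ⟨h1, h2, -⟩, rfl⟩ := (mem_config_iff_frame hQ hp q).mp hq
  exact ⟨ξ, η, z, h1, h2, rfl⟩

/-- The constants are the squared lengths of one special system. They are real because the special
parameters and the relation are invariant under conjugation, and `legParams_eq_iff` compares any
other real system with it. -/
theorem exists_self_motion_constants {P : Pentapod} {i j : Fin 5} {a₂ : ℂ}
    {Q : Matrix (Fin 3) (Fin 3) ℝ} (hQ : Q.transpose * Q = 1)
    (h : (P.inFrame i Q).IsAdapted i j a₂) :
    ∃ c : Fin 5 → ℝ, ∀ R : Fin 5 → ℝ, HasSelfMotion (P.config fun k => (R k : ℂ)) ↔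
      ∀ k l : Fin 5, R k ^ 2 - R l ^ 2 = c k - c l := by
  obtain ⟨a, ha⟩ : ∃ a : ℝ, (P.inFrame i Q).a j = a := ⟨_, rfl⟩
  obtain ⟨A, B, C, hM⟩ : ∃ A B C : ℝ, (P.inFrame i Q).M j = ![A, B, C] :=
    ⟨(P.inFrame i Q).M j 0, (P.inFrame i Q).M j 1, (P.inFrame i Q).M j 2, by
      ext k; fin_cases k <;> rfl⟩
  have ha0 : (a : ℂ) ≠ 0 := by
    have := h.a_ne_zero
    rw [ha] at this
    exact ofReal_ne_zero.mpr this
  -- the special leg lengths with `R i = 0`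
  obtain ⟨r, hr⟩ : ∃ r : ℂ, ((A : ℂ) ^ 2 + B ^ 2 + C ^ 2) * (a₂ + starRingEnd ℂ a₂ - a) +
      ((0 : ℂ) ^ 2 - r ^ 2 - a₂ * a - starRingEnd ℂ a₂ * a + a ^ 2) * a = 0 := by
    obtain ⟨r, hr⟩ := IsAlgClosed.exists_pow_nat_eq
      (((A : ℂ) ^ 2 + B ^ 2 + C ^ 2) * (a₂ + starRingEnd ℂ a₂ - a) / a - a₂ * a -
        starRingEnd ℂ a₂ * a + a ^ 2) (n := 2) two_pos
    refine ⟨r, ?_⟩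
    rw [hr]
    field_simp
    ring
  obtain ⟨S, hSi, hSj, hS⟩ := h.exists_legParams
    (-((starRingEnd ℂ a₂ - a) * (A - I * B)) / a) (-((a₂ - a) * (A + I * B)) / a) (C / a) 0 r
  have hr_conj : (starRingEnd ℂ r) ^ 2 = r ^ 2 := by
    have hr' := congrArg (starRingEnd ℂ) hr
    simp at hr'
    have : (a : ℂ) * ((starRingEnd ℂ r) ^ 2 - r ^ 2) = 0 := by linear_combination hr - hr'
    exact sub_eq_zero.mp ((mul_eq_zero.mp this).resolve_left ha0)
  -- The special system and its conjugate agree in their parameters, hence in all differences of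
  -- squares; since `S i = 0`, each square equals its own conjugate.
  have hreal : ∀ k, ((((S k) ^ 2).re : ℝ) : ℂ) = S k ^ 2 := by
    have hd := (h.legParams_eq_iff hS hS.conj).mp
      ⟨by simp [sub_eq_add_neg], by simp [sub_eq_add_neg], by simp, by
        rw [hSi, hSj]; simp [hr_conj]⟩
    intro k
    have := hd k i
    rw [hSi] at this
    simp only [map_zero] at this
    rw [← conj_eq_iff_re, map_pow]
    linear_combination -this
  refine ⟨fun k => ((S k) ^ 2).re, fun R => ?_⟩
  obtain ⟨⟨p₂, p₃, w⟩, hp, -⟩ := h.existsUnique_legParams fun k => (R k : ℂ)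
  rw [hasSelfMotion_iff hQ h hp ha hM (Or.inl fun k => by rw [← ofReal_pow, ofReal_im])]
  have hR : (∀ k l : Fin 5, R k ^ 2 - R l ^ 2 = ((S k) ^ 2).re - ((S l) ^ 2).re) ↔
      ∀ k l : Fin 5, (R k : ℂ) ^ 2 - (R l : ℂ) ^ 2 = S k ^ 2 - S l ^ 2 := by
    refine forall_congr' fun k => forall_congr' fun l => ?_
    rw [← hreal k, ← hreal l]
    norm_cast
  rw [hR, ← h.legParams_eq_iff hp hS, hSi, hSj]
  constructor
  · rintro ⟨h1, h2, h3, h4⟩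
    refine ⟨h2, h3, h1, ?_⟩
    have : (a : ℂ) * ((R i : ℂ) ^ 2 - (R j : ℂ) ^ 2 - (0 ^ 2 - r ^ 2)) = 0 := by
      linear_combination h4 - hr
    exact sub_eq_zero.mp ((mul_eq_zero.mp this).resolve_left ha0)
  · rintro ⟨h2, h3, h1, h4⟩
    exact ⟨h1, h2, h3, by linear_combination hr + a * h4⟩

end Pentapod

theorem mainTheorem7 (P : Pentapod) (hP : P.IsType5) (hD : P.DuporcqCondition) :
    -- the leg lengths with a self-motion form a one-parametric set
    (∃ c : Fin 5 → ℝ, ∀ R : Fin 5 → ℝ,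
      HasSelfMotion (P.config fun k => (R k : ℂ)) ↔
        ∀ k l : Fin 5, R k ^ 2 - R l ^ 2 = c k - c l) ∧
    -- the configuration set is never of dimension greater than one
    (∀ R : Fin 5 → ℂ, DimLEOne (P.config R)) ∧
    -- the leg parameters, for any two legs `i` (number 1) and `j` (number 5)
    ∀ i j : Fin 5, i ≠ j →
      (∃ (Q : Matrix (Fin 3) (Fin 3) ℝ) (a₂ : ℂ), P.IsAdaptedFrame i Q a₂) ∧
      ∀ (Q : Matrix (Fin 3) (Fin 3) ℝ) (a₂ : ℂ), P.IsAdaptedFrame i Q a₂ →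
        ∀ (a₃ : ℂ) (a₅ A₅ B₅ C₅ : ℝ), a₃ = starRingEnd ℂ a₂ →
          (P.inFrame i Q).a j = a₅ → (P.inFrame i Q).M j = ![A₅, B₅, C₅] →
          a₅ ≠ 0 ∧
          (∀ R : Fin 5 → ℂ, ∃! p : ℂ × ℂ × ℂ, P.HasLegParameters i j Q a₂ R p.1 p.2.1 p.2.2) ∧
          (∀ p₂ p₃ w R₁ R₅ : ℂ, ∃ R : Fin 5 → ℂ, R i = R₁ ∧ R j = R₅ ∧
            P.HasLegParameters i j Q a₂ R p₂ p₃ w) ∧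
          ∀ (R : Fin 5 → ℂ) (p₂ p₃ w : ℂ), P.HasLegParameters i j Q a₂ R p₂ p₃ w →
            ((∀ k, ((R k) ^ 2).im = 0) ∨ C₅ ^ 2 ≠ a₅ ^ 2) →
            (HasSelfMotion (P.config R) ↔
              w = C₅ / a₅ ∧
              p₂ = -((a₃ - a₅) * (A₅ - I * B₅)) / a₅ ∧
              p₃ = -((a₂ - a₅) * (A₅ + I * B₅)) / a₅ ∧
              ((A₅ : ℂ) ^ 2 + B₅ ^ 2 + C₅ ^ 2) * (a₂ + a₃ - a₅) +
                (R i ^ 2 - R j ^ 2 - a₂ * a₅ - a₃ * a₅ + a₅ ^ 2) * a₅ = 0) := by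
  have main : ∀ {i j : Fin 5}, i ≠ j → ∀ {Q : Matrix (Fin 3) (Fin 3) ℝ} {a₂ : ℂ},
      P.IsAdaptedFrame i Q a₂ → Q.transpose * Q = 1 ∧ (P.inFrame i Q).IsAdapted i j a₂ :=
    fun hij _ _ h => ⟨transpose_mul_self_of_mem h.rot, h.isAdapted hP.1.1 hD hij⟩
  have h01 : (0 : Fin 5) ≠ 1 := by decide
  -- The first two claims do not depend on the chosen pair of legs, so any pair will do.
  obtain ⟨Q, a₂, hF⟩ := Pentapod.exists_isAdaptedFrame hP hD 0
  obtain ⟨hQ, hA⟩ := main h01 hF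
  refine ⟨Pentapod.exists_self_motion_constants hQ hA, Pentapod.dimLEOne_config hQ hA, ?_⟩
  intro i j hij
  refine ⟨Pentapod.exists_isAdaptedFrame hP hD i, ?_⟩
  rintro Q a₂ hF a₃ a₅ A₅ B₅ C₅ rfl ha hM
  obtain ⟨hQ, hA⟩ := main hij hF
  refine ⟨ha ▸ hA.a_ne_zero, hA.existsUnique_legParams, hA.exists_legParams, ?_⟩
  intro R p₂ p₃ w hp hR
  exact Pentapod.hasSelfMotion_iff hQ hA hp ha hM hR
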